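/- Let $\mathcal F$ be the set of real-rational functions of $\mathbf z$ without poles on the unit circle; each $P\in\mathcal F$ has a unique expansion $P(\mathbf z)=\sum_{k\in\mathbb Z}p_k\mathbf z^{-k}$ on $|\mathbf z|=1$, acts on processes by $(P(\mathbf z)x)(t)=\sum_k p_{t-k}x(k)$, and is causal, $P\in\mathcal F^+$, if $p_k=0$ for all $k<0$. A linear dynamic influence model (LDIM) with finite node set $V$ consists of real, jointly wide-sense stationary, square-integrable vector processes $y=(y_v)_{v\in V}$ on $\mathbb Z$ (each $y_v$ of some finite dimension) with $$y=Q(\mathbf z)y+e,\qquad e=P(\mathbf z)u,$$ where $Q$ has entries in $\mathcal F$, $P$ has entries in $\mathcal F^+$ and is block diagonal with respect to the nodes, and $u=(u_v)_{v\in V}$ is white with $\Phi_u=\mathcal I$ (i.e. $\mathbf E[u(t)u(s)^T]=\delta_{ts}\mathcal I$). It is causal if the entries of $Q$ are in $\mathcal F^+$, and well-posed (causally well-posed) if for every $S\subseteq V$ the matrix $\mathcal I-Q_{SS}$ is invertible with inverse having entries in $\mathcal F$ (in $\mathcal F^+$). A directed graph $G$ on $V$ (self-loops and cycles allowed) is a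 graphical representation if $Q_{ji}=0$ whenever $(i,j)$ is not an edge. A path between $i$ and $j$ is a sequence of nodes $i=\pi_1,\dots,\pi_\ell=j$ with distinct ordered pairs $(\pi_p,\pi_{p+1})$, together with a choice, for each $p$, of an arrow $\pi_p\to\pi_{p+1}$ or $\pi_p\leftarrow\pi_{p+1}$ that is an edge of $G$; $\pi_p$ ($1<p<\ell$) is a collider if $\pi_{p-1}\to\pi_p\leftarrow\pi_{p+1}$ appears in the path. For disjoint $I,Z,J\subseteq V$, $Z$ d-separates $I$ and $J$ if every path between a node of $I$ and a node of $J$ contains a node of $Z$ that is not a collider, or a collider such that neither it nor any of its descendants is in $Z$. For $S\subseteq V$ let $\mathrm{tfspan}(y_S)$ (resp. $\mathrm{ctfspan}(y_S)$) be the set of the processes $W(\mathbf z)y_S$, $W$ a matrix with entries in $\mathcal F$ (resp. $\mathcal F^+$). A Wiener estimate (resp. causal Wiener estimate) of $y_J$ from $y_S$ is an element $q$ of this set, with the dimension of $y_J$, that minimizes $\mathbf E[(y_J-q)^T(y_J-q)]$ over it; if $q=W(\mathbf z)y_S$, then $W$ is called a (causal) Wiener filter. Write $\mathrm{wsep}(y_I,y_Z,y_J)$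 if (i) the Wiener estimates of $y_J$ from $(y_I,y_Z)$ and those from $y_Z$ are the same, and every element of $\mathrm{tfspan}(y_I,y_Z)$ is matched by an element of $\mathrm{tfspan}(y_Z)$ with mean square error that is no larger, so that the two minimization problems have the same infimum; and (ii) if the power spectral density of $(y_I,y_Z)$ is positive definite at every point of the unit circle, then the Wiener filter estimating $y_J$ from $(y_I,y_Z)$ exists, is unique, and its components acting on $y_I$ are zero. Write $\mathrm{cwsep}(y_I,y_Z,y_J)$ for the same with causal Wiener estimates, causal Wiener filters and $\mathrm{ctfspan}$. **Theorem.** Consider a well-posed LDIM with graphical representation $G$, and let $I,Z,J\subseteq V$ be pairwise disjoint. If $Z$ d-separates $I$ and $J$ in $G$, then $\mathrm{wsep}(y_I,y_Z,y_J)$. If moreover the LDIM is causal and causally well-posed, then also $\mathrm{cwsep}(y_I,y_Z,y_J)$. -/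

import Mathlib

open MeasureTheory
open scoped ComplexOrder

noncomputable section

/-! ### Directed graphs, oriented paths, d-separation -/

/-- A path between `i` and `j` in a directed graph: a sequence of nodes
`node 0, ..., node len` where each consecutive pair is joined by an edge of `G`, listed together
with the arrow by which it is traversed: `right p = true` means that
`node p → node (p+1)` appears in the path, `right p = false` that `node p ← node (p+1)` does
(if both edges are in `G`, these are different paths).
The ordered pairs `(node p, node (p+1))` are distinct. Values beyond `len` are irrelevant. -/
structure DiPath {V : Type*} (G : Digraph V) (i j : V) where
  len : ℕ
  node : ℕ → V
  right : ℕ → Bool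
  node_zero : node 0 = i
  node_len : node len = j
  adj_right : ∀ p < len, right p = true → G.Adj (node p) (node (p + 1))
  adj_left : ∀ p < len, right p = false → G.Adj (node (p + 1)) (node p)
  distinct : ∀ p q, p < q → q < len → (node p, node (p + 1)) ≠ (node q, node (q + 1))

/-- `node p` is a collider of the path: `node (p-1) → node p ← node (p+1)` appears in it. -/
def DiPath.IsCollider {V : Type*} {G : Digraph V} {i j : V} (π : DiPath G i j) (p : ℕ) : Prop :=
  0 < p ∧ p < π.len ∧ π.right (p - 1) = true ∧ π.right p = false

/-- `w` is a descendant of `v`: `w = v` or there is a directed chain from `v` to `w`. -/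
def IsDescendant {V : Type*} (G : Digraph V) (v w : V) : Prop :=
  Relation.ReflTransGen G.Adj v w

/-- The path contains a node of `Z` that is not a collider, or a collider none of whose
descendants (itself included) belongs to `Z`. -/
def DiPath.Blocked {V : Type*} {G : Digraph V} {i j : V} (π : DiPath G i j) (Z : Finset V) :
    Prop :=
  (∃ p ≤ π.len, π.node p ∈ Z ∧ ¬ π.IsCollider p) ∨
    (∃ p, π.IsCollider p ∧ ∀ w, IsDescendant G (π.node p) w → w ∉ Z)

/-- `Z` d-separates `I` and `J` in `G`. -/
def DSep {V : Type*} (G : Digraph V) (I Z J : Finset V) : Prop :=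
  ∀ i ∈ I, ∀ j ∈ J, ∀ π : DiPath G i j, π.Blocked Z

/-! ### Transfer functions -/

/-- The value of a real-rational function at a complex number. -/
def tfEval (P : RatFunc ℝ) (z : ℂ) : ℂ := RatFunc.eval (algebraMap ℝ ℂ) z P

/-- Real-rational transfer functions without poles on the unit circle. -/
def tfF : Set (RatFunc ℝ) :=
  {P | ∀ z : ℂ, ‖z‖ = 1 → P.denom.eval₂ (algebraMap ℝ ℂ) z ≠ 0}

/-- `p` is a bi-infinite real sequence with `P(z) = ∑ p_k z^{-k}` on the unit circle. -/
def IsImpulseResponse (P : RatFunc ℝ) (p : ℤ → ℝ) : Prop :=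
  ∀ z : ℂ, ‖z‖ = 1 → HasSum (fun k : ℤ => (p k : ℂ) * z ^ (-k)) (tfEval P z)

open Classical in
/-- The impulse response of a transfer function (it exists and is unique for `P ∈ tfF`;
the value is `0` if there is none). -/
def impulse (P : RatFunc ℝ) : ℤ → ℝ :=
  if h : ∃ p, IsImpulseResponse P p then h.choose else 0

/-- Causal transfer functions. -/
def tfFplus : Set (RatFunc ℝ) := {P | P ∈ tfF ∧ ∀ k < 0, impulse P k = 0}

/-! ### Processes and filters -/

/-- The output `W(z) x` of a transfer matrix: convolution with the impulse responses. -/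
def applyTF {Ω κ ι : Type*} [Fintype ι] (W : Matrix κ ι (RatFunc ℝ)) (x : ι → ℤ → Ω → ℝ) :
    κ → ℤ → Ω → ℝ :=
  fun a t ω => ∑ b, ∑' k : ℤ, impulse (W a b) (t - k) * x b k ω

/-- A vector of jointly wide-sense stationary real processes. -/
structure IsWSS {Ω ι : Type*} [MeasurableSpace Ω] (μ : Measure Ω) (x : ι → ℤ → Ω → ℝ) :
    Prop where
  memLp : ∀ a t, MemLp (x a t) 2 μ
  mean : ∀ a t, ∫ ω, x a t ω ∂μ = ∫ ω, x a 0 ω ∂μ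
  corr : ∀ a b t s, ∫ ω, x a (t + s) ω * x b t ω ∂μ = ∫ ω, x a s ω * x b 0 ω ∂μ

/-- White noise with power spectral density identically the identity matrix. -/
structure IsUnitWhite {Ω ι : Type*} [DecidableEq ι] [MeasurableSpace Ω] (μ : Measure Ω)
    (u : ι → ℤ → Ω → ℝ) : Prop where
  memLp : ∀ a t, MemLp (u a t) 2 μ
  corr : ∀ a b t s, ∫ ω, u a t ω * u b s ω ∂μ = if a = b ∧ t = s then 1 else 0

/-- The power spectral density matrix `∑_τ E[x(τ) x(0)ᵀ] z^{-τ}`. -/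
def psd {Ω ι : Type*} [MeasurableSpace Ω] (μ : Measure Ω) (x : ι → ℤ → Ω → ℝ) (z : ℂ) :
    Matrix ι ι ℂ :=
  fun a b => ∑' τ : ℤ, ((∫ ω, x a τ ω * x b 0 ω ∂μ : ℝ) : ℂ) * z ^ (-τ)

/-- The span of the processes `x` by transfer functions of the class `𝒯`, as a set of vector
processes indexed by `κ`; `𝒯 = tfF` is the tfspan and `𝒯 = tfFplus` the ctfspan.
Random variables are identified when they agree almost surely. -/
def tfSpan {Ω ι : Type*} [Fintype ι] [MeasurableSpace Ω] (μ : Measure Ω) (𝒯 : Set (RatFunc ℝ))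
    (x : ι → ℤ → Ω → ℝ) (κ : Type*) : Set (κ → ℤ → Ω → ℝ) :=
  {q | ∃ W : Matrix κ ι (RatFunc ℝ), (∀ a b, W a b ∈ 𝒯) ∧ ∀ a t, q a t =ᵐ[μ] applyTF W x a t}

/-- The mean square error `E[(x(t) - q(t))ᵀ (x(t) - q(t))]`. -/
def mse {Ω κ : Type*} [Fintype κ] [MeasurableSpace Ω] (μ : Measure Ω) (x q : κ → ℤ → Ω → ℝ)
    (t : ℤ) : ℝ :=
  ∫ ω, ∑ a, (x a t ω - q a t ω) ^ 2 ∂μ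

/-- `q` is the Wiener estimate of `x` from `y` within the class `𝒯` of transfer functions. -/
def IsWienerEstimate {Ω ι κ : Type*} [Fintype ι] [Fintype κ] [MeasurableSpace Ω]
    (μ : Measure Ω) (𝒯 : Set (RatFunc ℝ)) (y : ι → ℤ → Ω → ℝ) (x q : κ → ℤ → Ω → ℝ) : Prop :=
  q ∈ tfSpan μ 𝒯 y κ ∧ ∀ q' ∈ tfSpan μ 𝒯 y κ, ∀ t, mse μ x q t ≤ mse μ x q' t

/-- `W` is the Wiener filter estimating `x` from `y` within the class `𝒯`. -/
def IsWienerFilter {Ω ι κ : Type*} [Fintype ι] [Fintype κ] [MeasurableSpace Ω]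
    (μ : Measure Ω) (𝒯 : Set (RatFunc ℝ)) (y : ι → ℤ → Ω → ℝ) (x : κ → ℤ → Ω → ℝ)
    (W : Matrix κ ι (RatFunc ℝ)) : Prop :=
  (∀ a b, W a b ∈ 𝒯) ∧ IsWienerEstimate μ 𝒯 y x (applyTF W y)

/-! ### Networks of vector processes -/

/-- Scalar components of a vector signal with one block of dimension `d v` for each node `v`. -/
abbrev Comp {V : Type*} (d : V → ℕ) := (v : V) × Fin (d v)

/-- Scalar components of the nodes in `S`. -/
abbrev CompOn {V : Type*} (d : V → ℕ) (S : Finset V) := {c : Comp d // c.1 ∈ S}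

/-- The vector signal of the nodes in `S`. -/
def restrictTo {V Ω : Type*} {d : V → ℕ} (y : Comp d → ℤ → Ω → ℝ) (S : Finset V) :
    CompOn d S → ℤ → Ω → ℝ :=
  fun c => y c.1

/-- The Wiener estimate of `y_J` from `(y_I, y_Z)` and the one from `y_Z` are identical. -/
def EstimatesCoincide {V Ω : Type*} [Fintype V] [DecidableEq V] [MeasurableSpace Ω]
    (μ : Measure Ω) (𝒯 : Set (RatFunc ℝ)) {d : V → ℕ} (y : Comp d → ℤ → Ω → ℝ)
    (I Z J : Finset V) : Prop :=
  ∀ q : CompOn d J → ℤ → Ω → ℝ,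
    IsWienerEstimate μ 𝒯 (restrictTo y (I ∪ Z)) (restrictTo y J) q ↔
      IsWienerEstimate μ 𝒯 (restrictTo y Z) (restrictTo y J) q

/-- There is exactly one Wiener filter estimating `y_J` from `(y_I, y_Z)`, and all its
components acting on `y_I` are zero. -/
def FilterVanishesOn {V Ω : Type*} [Fintype V] [DecidableEq V] [MeasurableSpace Ω]
    (μ : Measure Ω) (𝒯 : Set (RatFunc ℝ)) {d : V → ℕ} (y : Comp d → ℤ → Ω → ℝ)
    (I Z J : Finset V) : Prop :=
  ∃ W : Matrix (CompOn d J) (CompOn d (I ∪ Z)) (RatFunc ℝ),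
    IsWienerFilter μ 𝒯 (restrictTo y (I ∪ Z)) (restrictTo y J) W ∧
    (∀ W', IsWienerFilter μ 𝒯 (restrictTo y (I ∪ Z)) (restrictTo y J) W' → W' = W) ∧
    ∀ a b, b.1.1 ∈ I → W a b = 0

/-- Adding `y_I` to `y_Z` does not improve the least squares problem for `y_J`: every estimate
from `(y_I, y_Z)` is matched by one from `y_Z` (so the infima of the two problems agree, also if
they are not attained). -/
def NoImprovement {V Ω : Type*} [Fintype V] [DecidableEq V] [MeasurableSpace Ω]
    (μ : Measure Ω) (𝒯 : Set (RatFunc ℝ)) {d : V → ℕ} (y : Comp d → ℤ → Ω → ℝ)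
    (I Z J : Finset V) : Prop :=
  ∀ q ∈ tfSpan μ 𝒯 (restrictTo y (I ∪ Z)) (CompOn d J),
    ∃ q' ∈ tfSpan μ 𝒯 (restrictTo y Z) (CompOn d J),
      ∀ t, mse μ (restrictTo y J) q' t ≤ mse μ (restrictTo y J) q t

/-- Wiener separation within the class `𝒯`: the two least squares problems have the same
optimal value and the same solutions (Wiener estimates) and, whenever the spectral
density of `(y_I, y_Z)` is positive definite on the unit circle (so that the Wiener filter is
well defined), the components of the Wiener filter acting on `y_I` vanish. -/
def WienerSepIn {V Ω : Type*} [Fintype V] [DecidableEq V] [MeasurableSpace Ω]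
    (μ : Measure Ω) (𝒯 : Set (RatFunc ℝ)) {d : V → ℕ} (y : Comp d → ℤ → Ω → ℝ)
    (I Z J : Finset V) : Prop :=
  EstimatesCoincide μ 𝒯 y I Z J ∧ NoImprovement μ 𝒯 y I Z J ∧
    ((∀ z : ℂ, ‖z‖ = 1 → (psd μ (restrictTo y (I ∪ Z)) z).PosDef) →
      FilterVanishesOn μ 𝒯 y I Z J)

/-- Non-causal Wiener separation. -/
def WSep {V Ω : Type*} [Fintype V] [DecidableEq V] [MeasurableSpace Ω] (μ : Measure Ω)
    {d : V → ℕ} (y : Comp d → ℤ → Ω → ℝ) (I Z J : Finset V) : Prop :=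
  WienerSepIn μ tfF y I Z J

/-- Causal Wiener separation. -/
def CWSep {V Ω : Type*} [Fintype V] [DecidableEq V] [MeasurableSpace Ω] (μ : Measure Ω)
    {d : V → ℕ} (y : Comp d → ℤ → Ω → ℝ) (I Z J : Finset V) : Prop :=
  WienerSepIn μ tfFplus y I Z J

/-! ### Linear dynamic influence models -/

/-- A linear dynamic influence model `y = Q(z) y + e`, `e = P(z) u`, with node set `V`; the node
signal `y_v` has dimension `d v` and the input `u_v` has dimension `m v`. -/
structure LDIM {V Ω : Type*} [Fintype V] [DecidableEq V] [MeasurableSpace Ω] (μ : Measure Ω)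
    (d m : V → ℕ) where
  Q : Matrix (Comp d) (Comp d) (RatFunc ℝ)
  P : Matrix (Comp d) (Comp m) (RatFunc ℝ)
  u : Comp m → ℤ → Ω → ℝ
  y : Comp d → ℤ → Ω → ℝ
  Q_mem : ∀ a b, Q a b ∈ tfF
  P_mem : ∀ a b, P a b ∈ tfFplus
  P_blockDiagonal : ∀ a b, a.1 ≠ b.1 → P a b = 0
  u_white : IsUnitWhite μ u
  y_wss : IsWSS μ y
  dynamics : ∀ a t, y a t =ᵐ[μ] fun ω => applyTF Q y a t ω + applyTF P u a t ω

namespace LDIM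

variable {V Ω : Type*} [Fintype V] [DecidableEq V] [MeasurableSpace Ω] {μ : Measure Ω}
  {d m : V → ℕ}

/-- All entries of `Q` are causal. -/
def IsCausal (L : LDIM μ d m) : Prop := ∀ a b, L.Q a b ∈ tfFplus

/-- For every set `S` of nodes, `𝓘 - Q_SS` has an inverse with entries in `𝒯`. -/
def InvertibleIn (L : LDIM μ d m) (𝒯 : Set (RatFunc ℝ)) : Prop :=
  ∀ S : Finset V, ∃ N : Matrix (CompOn d S) (CompOn d S) (RatFunc ℝ),
    (1 - L.Q.submatrix Subtype.val Subtype.val) * N = 1 ∧ ∀ a b, N a b ∈ 𝒯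

/-- Well-posedness: the inverses exist and have no poles on the unit circle. -/
def IsWellPosed (L : LDIM μ d m) : Prop := L.InvertibleIn tfF

/-- Causal well-posedness: the inverses exist and are causal, without poles on the circle. -/
def IsCausallyWellPosed (L : LDIM μ d m) : Prop := L.InvertibleIn tfFplus

/-- `G` is a graphical representation: `Q_ji = 0` unless `G` has the edge `i → j`. -/
def IsRepresentedBy (L : LDIM μ d m) (G : Digraph V) : Prop :=
  ∀ i j, ¬ G.Adj i j → ∀ (a : Fin (d j)) (b : Fin (d i)), L.Q ⟨j, a⟩ ⟨i, b⟩ = 0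

end LDIM

end

/-!
A jointly wide-sense stationary, square-integrable process is a bounded sequence in the Hilbert
space `L²`, on which a filter without poles on the unit circle acts by convolution with its
absolutely summable impulse response. The bounded sequences thus form a module over the ring of
transfer functions, in which `y = Q(𝐳) y + e` is a linear system.

Suppose that `Z` d-separates `I` and `J`. Among the ancestors of `I ∪ Z ∪ J` outside `Z`, let `K` be
those that are reached from `I` along walks active given `Z`, and `L` the other ones, so that
`I ⊆ K` and `J ⊆ L`. Then `Z` splits into `ZL`, the nodes of `Z` with a parent in `L`, and the
remaining part `ZK`, and all parents of `K ∪ ZK` are in `K ∪ Z`, those of `L ∪ ZL` in `L ∪ Z`. Let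
`ηK` and `ηL` be the responses of the subnetworks `K` and `L` to their own inputs. Then `y - ηK` on
`K` and `y - ηL` on `L` are combinations of `y_Z`. Inverting `𝓘 - Q` on `K ∪ L ∪ Z`, they are even
sums `p + p'` of combinations of `y_Z` such that `p` is also a combination of the inputs of
`K ∪ ZK`, and `p'` one of those of `L ∪ ZL`. Hence for each combination `q` of `y_I` and `y_Z` there
is a combination `q'` of `y_Z` such that `y_J - q'` is driven by the inputs of `L ∪ ZL`, and
`q - q'` by those of `K ∪ ZK`. As inputs of different nodes are orthogonal, by Pythagoras `q'` is at
least as good an estimate of `y_J` as `q`.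

If the spectrum is positive definite, it is invertible over the ring of transfer functions, which
makes the Wiener filter unique. For its existence, project `y_J(0)` onto the closed span of the
observed samples. The coefficients of the projection solve the Wiener–Hopf equations, and clearing
denominators shows that they are the impulse responses of rational functions.
-/

open scoped BoundedContinuousFunction

noncomputable section

/-! ### Laurent series on the unit circle -/

section Convolution

variable {G 𝕜 B : Type*} [NormedField 𝕜]

theorem summable_norm_smul_of_norm_le_one [SeminormedAddCommGroup B] [NormedSpace 𝕜 B] {S : G → B}
    (hS : ∀ a, ‖S a‖ ≤ 1) {p : G → 𝕜} (hp : Summable fun k => ‖p k‖) :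
    Summable fun k => ‖p k • S k‖ := by
  refine hp.of_nonneg_of_le (fun _ => norm_nonneg _) fun k => ?_
  rw [norm_smul]
  exact mul_le_of_le_one_right (norm_nonneg _) (hS k)

variable [AddCommGroup G] [CompleteSpace 𝕜] {p q : G → 𝕜}

theorem summable_mul_sub (hp : Summable fun k => ‖p k‖) (hq : Summable fun k => ‖q k‖) (n : G) :
    Summable fun k => p k * q (n - k) := by
  have hinj : Function.Injective fun k : G => (k, n - k) := fun _ _ h => (Prod.ext_iff.1 h).1
  simpa only [Function.comp_def] using (summable_mul_of_summable_norm hp hq).comp_injective hinj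

theorem hasSum_conv_smul [NormedRing B] [NormedAlgebra 𝕜 B] [CompleteSpace B] {S : G → B}
    (hmul : ∀ a b, S (a + b) = S a * S b) (hS : ∀ a, ‖S a‖ ≤ 1)
    (hp : Summable fun k => ‖p k‖) (hq : Summable fun k => ‖q k‖) :
    HasSum (fun n => (∑' k, p k * q (n - k)) • S n) ((∑' k, p k • S k) * ∑' k, q k • S k) := by
  have hp' := summable_norm_smul_of_norm_le_one hS hp
  have hq' := summable_norm_smul_of_norm_le_one hS hq
  have h := (summable_mul_of_summable_norm hp' hq').hasSum
  rw [← tsum_mul_tsum_of_summable_norm hp' hq'] at h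
  let e : G × G ≃ G × G :=
    { toFun := fun x => (x.2, x.1 - x.2)
      invFun := fun x => (x.1 + x.2, x.1)
      left_inv := fun x => by simp
      right_inv := fun x => by simp }
  refine HasSum.prod_fiberwise (e.hasSum_iff.2 h) fun n => ?_
  convert! (summable_mul_sub hp hq n).hasSum.smul_const (S n) using 2 with k
  simp [e, smul_smul, mul_comm, ← hmul]

end Convolution

/-- `f` is given on the unit circle by the absolutely summable Laurent series `∑ c k z⁻ᵏ`. -/
def HasLaurent (f : ℂ → ℂ) (c : ℤ → ℂ) : Prop :=
  ∀ z : ℂ, ‖z‖ = 1 → HasSum (fun k : ℤ => c k * z ^ (-k)) (f z)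

theorem ne_zero_of_norm_eq_one {E : Type*} [SeminormedAddGroup E] {z : E} (hz : ‖z‖ = 1) :
    z ≠ 0 :=
  ne_zero_of_norm_ne_zero (hz ▸ one_ne_zero)

namespace HasLaurent

variable {f g : ℂ → ℂ} {c d : ℤ → ℂ}

theorem summable_norm (h : HasLaurent f c) : Summable fun k => ‖c k‖ := by
  simpa using (h 1 norm_one).summable.norm

theorem mul (hf : HasLaurent f c) (hg : HasLaurent g d) :
    HasLaurent (fun z => f z * g z) (fun n => ∑' k, c k * d (n - k)) := by
  intro z hz
  have h := hasSum_conv_smul (S := fun k : ℤ => z ^ (-k))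
    (fun a b => by rw [neg_add, zpow_add₀ (ne_zero_of_norm_eq_one hz)])
    (fun a => by simp [norm_zpow, hz]) hf.summable_norm hg.summable_norm
  simpa only [smul_eq_mul, (hf z hz).tsum_eq, (hg z hz).tsum_eq] using h

theorem add (hf : HasLaurent f c) (hg : HasLaurent g d) :
    HasLaurent (fun z => f z + g z) (fun n => c n + d n) := by
  intro z hz
  simpa only [add_mul] using (hf z hz).add (hg z hz)

theorem congr (hf : HasLaurent f c) (h : ∀ z : ℂ, ‖z‖ = 1 → f z = g z) : HasLaurent g c :=
  fun z hz => h z hz ▸ hf z hz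

theorem hasSum_fourier (h : HasLaurent 0 c) :
    HasSum (fun k : ℤ => c k • (fourier (-k) : C(AddCircle (1 : ℝ), ℂ))) 0 := by
  have : Fact (0 < (1 : ℝ)) := ⟨one_pos⟩
  have hs : Summable fun k : ℤ => c k • (fourier (-k) : C(AddCircle (1 : ℝ), ℂ)) := by
    refine Summable.of_norm ?_
    simpa only [norm_smul, fourier_norm, mul_one] using h.summable_norm
  convert hs.hasSum
  ext x
  refine (h (AddCircle.toCircle x) (Circle.norm_coe _)).unique ?_
  convert! ContinuousMap.hasSum_apply hs.hasSum x using 2 with k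
  rw [ContinuousMap.smul_apply, fourier_apply, AddCircle.toCircle_zsmul, Circle.coe_zpow,
    smul_eq_mul]

theorem eq_zero (h : HasLaurent 0 c) : c = 0 := by
  have : Fact (0 < (1 : ℝ)) := ⟨one_pos⟩
  ext j
  have hinner := (h.hasSum_fourier.mapL
    (ContinuousMap.toLp (E := ℂ) 2 AddCircle.haarAddCircle ℂ)).mapL
      (innerSL ℂ (fourierLp (T := (1 : ℝ)) 2 (-j)))
  have horth (k : ℤ) : innerSL ℂ (fourierLp (T := (1 : ℝ)) 2 (-j)) (fourierLp 2 (-k)) =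
      if k = j then 1 else 0 := by
    rw [innerSL_apply_apply, orthonormal_iff_ite.1 (orthonormal_fourier (T := (1 : ℝ)))]
    simp [eq_comm]
  have hsingle : HasSum (fun k => if k = j then c j else 0) (0 : ℂ) := by
    convert! hinner using 1
    · ext k
      rw [map_smul, map_smul, ← fourierLp, horth]
      split_ifs with hk <;> simp [hk]
    · simp
  exact (hasSum_ite_eq j (c j)).unique hsingle

theorem unique (hc : HasLaurent f c) (hd : HasLaurent f d) : c = d := by
  have h : HasLaurent 0 (fun k => c k - d k) := by
    intro z hz
    simpa [sub_mul] using (hc z hz).sub (hd z hz)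
  ext k
  exact sub_eq_zero.1 (congrFun h.eq_zero k)

end HasLaurent

theorem hasLaurent_zpow (a : ℂ) (n : ℤ) :
    HasLaurent (fun z => a * z ^ (-n)) (fun k => if k = n then a else 0) := by
  intro z _
  convert! hasSum_ite_eq n (a * z ^ (-n)) using 2 with k
  split_ifs with hk <;> simp [hk]

theorem hasLaurent_inv_sub_of_norm_lt_one {a : ℂ} (ha : ‖a‖ < 1) :
    HasLaurent (fun z => (z - a)⁻¹) fun k => if 1 ≤ k then a ^ (k - 1) else 0 := by
  intro z hz
  have hz0 := ne_zero_of_norm_eq_one hz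
  have hinj : Function.Injective fun n : ℕ => (n : ℤ) + 1 := fun m n h => by simpa using h
  rw [← hinj.hasSum_iff]
  · have h := (hasSum_geometric_of_norm_lt_one (ξ := a * z⁻¹) (by simpa [hz] using ha)).mul_right
      z⁻¹
    convert! h using 1
    · ext n
      have : (1 : ℤ) ≤ n + 1 := by lia
      simp only [Function.comp, if_pos this, add_sub_cancel_right, zpow_natCast, mul_pow]
      rw [neg_add, zpow_add₀ hz0, zpow_neg, zpow_natCast, zpow_neg_one, inv_pow]
      ring
    · rw [← mul_inv]
      field_simp
  · intro k hk
    have : ¬ 1 ≤ k := fun h => hk ⟨(k - 1).toNat, by dsimp only; lia⟩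
    simp [this]

theorem hasLaurent_inv_sub_of_one_lt_norm {a : ℂ} (ha : 1 < ‖a‖) :
    HasLaurent (fun z => (z - a)⁻¹) fun k => if k ≤ 0 then -a ^ (k - 1) else 0 := by
  intro z hz
  have ha0 : a ≠ 0 := ne_zero_of_norm_ne_zero (by linarith)
  have hza : z - a ≠ 0 := fun h => by rw [sub_eq_zero.1 h] at hz; linarith
  have hinj : Function.Injective fun n : ℕ => -(n : ℤ) := fun m n h => by simpa using h
  rw [← hinj.hasSum_iff]
  · have h := (hasSum_geometric_of_norm_lt_one (ξ := z * a⁻¹)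
      (by simpa [hz] using inv_lt_one_of_one_lt₀ ha)).mul_right (-a⁻¹)
    convert! h using 1
    · ext n
      have : -(n : ℤ) ≤ 0 := by lia
      simp only [Function.comp, if_pos this, mul_pow, neg_neg, zpow_natCast]
      rw [zpow_sub₀ ha0, zpow_neg, zpow_natCast, zpow_one, inv_pow]
      ring
    · have : 1 - z * a⁻¹ ≠ 0 := by
        intro h
        apply hza
        field_simp at h
        linear_combination -h
      rw [inv_eq_iff_eq_inv, mul_inv, inv_inv, inv_neg, inv_inv]
      field_simp
      ring
  · intro k hk
    have : ¬ k ≤ 0 := fun h => hk ⟨(-k).toNat, by dsimp only; lia⟩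
    simp [this]

theorem exists_hasLaurent_inv_multiset_prod (s : Multiset ℂ) (hs : ∀ a ∈ s, ‖a‖ ≠ 1) :
    ∃ c, HasLaurent (fun z => ((s.map fun a => z - a).prod)⁻¹) c := by
  induction s using Multiset.induction_on with
  | empty => exact ⟨_, (hasLaurent_zpow 1 0).congr fun z _ => by simp⟩
  | cons a s ih =>
    obtain ⟨c, hc⟩ := ih fun b hb => hs b (Multiset.mem_cons_of_mem hb)
    obtain ⟨d, hd⟩ : ∃ d, HasLaurent (fun z => (z - a)⁻¹) d :=
      (lt_or_gt_of_ne (hs a (Multiset.mem_cons_self a s))).elim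
        (fun ha => ⟨_, hasLaurent_inv_sub_of_norm_lt_one ha⟩)
        fun ha => ⟨_, hasLaurent_inv_sub_of_one_lt_norm ha⟩
    exact ⟨_, (hd.mul hc).congr fun z _ => by simp [mul_comm]⟩

theorem exists_hasLaurent_polynomial (p : Polynomial ℂ) :
    ∃ c, HasLaurent (fun z => p.eval z) c := by
  induction p using Polynomial.induction_on' with
  | add p q hp hq =>
    obtain ⟨c, hc⟩ := hp
    obtain ⟨d, hd⟩ := hq
    exact ⟨_, (hc.add hd).congr fun z _ => by simp⟩
  | monomial n a => exact ⟨_, (hasLaurent_zpow a (-n)).congr fun z _ => by simp⟩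

theorem exists_hasLaurent_tfEval {P : RatFunc ℝ} (hP : P ∈ tfF) :
    ∃ c, HasLaurent (tfEval P) c := by
  set q : Polynomial ℂ := P.denom.map (algebraMap ℝ ℂ) with hq
  have hq0 : q ≠ 0 := (Polynomial.map_ne_zero_iff (algebraMap ℝ ℂ).injective).2 P.denom_ne_zero
  have hroot : ∀ a ∈ q.roots, ‖a‖ ≠ 1 := by
    intro a ha h1
    refine hP a h1 ?_
    rw [← Polynomial.eval_map]
    exact (Polynomial.mem_roots hq0).1 ha
  obtain ⟨c, hc⟩ := exists_hasLaurent_inv_multiset_prod _ hroot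
  obtain ⟨d, hd⟩ := exists_hasLaurent_polynomial
    (Polynomial.C (q.leadingCoeff)⁻¹ * P.num.map (algebraMap ℝ ℂ))
  refine ⟨_, (hd.mul hc).congr fun z _ => ?_⟩
  have hfac : q.eval z = q.leadingCoeff * (q.roots.map fun a => z - a).prod := by
    conv_lhs => rw [(IsAlgClosed.splits q).eq_prod_roots]
    simp [Polynomial.eval_multiset_prod]
  rw [tfEval, RatFunc.eval, ← Polynomial.eval_map, ← Polynomial.eval_map, ← hq, hfac]
  simp only [Polynomial.eval_mul, Polynomial.eval_C, div_eq_mul_inv, mul_inv]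
  ring

theorem tfEval_conj (P : RatFunc ℝ) (z : ℂ) :
    tfEval P (starRingEnd ℂ z) = starRingEnd ℂ (tfEval P z) := by
  have h (p : Polynomial ℝ) : p.eval₂ (algebraMap ℝ ℂ) (starRingEnd ℂ z) =
      starRingEnd ℂ (p.eval₂ (algebraMap ℝ ℂ) z) := by
    rw [Polynomial.hom_eval₂]
    congr 1
    ext x
    simp
  simp [tfEval, RatFunc.eval, h]

theorem exists_isImpulseResponse {P : RatFunc ℝ} (hP : P ∈ tfF) : ∃ p, IsImpulseResponse P p := by
  obtain ⟨c, hc⟩ := exists_hasLaurent_tfEval hP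
  refine ⟨fun k => (c k).re, fun z hz => ?_⟩
  have hconj := Complex.hasSum_conj'.2 (hc (starRingEnd ℂ z) (by simpa using hz))
  rw [tfEval_conj] at hconj
  simp only [map_mul, map_zpow₀, Complex.conj_conj] at hconj
  convert! ((hc z hz).add hconj).div_const 2 using 1
  · ext k
    rw [Complex.re_eq_add_conj]
    ring
  · simp

namespace IsImpulseResponse

variable {P : RatFunc ℝ} {p q : ℤ → ℝ}

theorem hasLaurent (h : IsImpulseResponse P p) : HasLaurent (tfEval P) (fun k => (p k : ℂ)) := h

theorem unique (hp : IsImpulseResponse P p) (hq : IsImpulseResponse P q) : p = q := by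
  ext k
  exact_mod_cast congrFun (hp.hasLaurent.unique hq.hasLaurent) k

end IsImpulseResponse

theorem isImpulseResponse_impulse {P : RatFunc ℝ} (hP : P ∈ tfF) :
    IsImpulseResponse P (impulse P) := by
  have h := exists_isImpulseResponse hP
  rw [impulse, dif_pos h]
  exact h.choose_spec

theorem IsImpulseResponse.impulse_eq {P : RatFunc ℝ} (hP : P ∈ tfF) {p : ℤ → ℝ}
    (hp : IsImpulseResponse P p) : impulse P = p :=
  (isImpulseResponse_impulse hP).unique hp

theorem summable_norm_impulse {P : RatFunc ℝ} (hP : P ∈ tfF) :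
    Summable fun k => ‖impulse P k‖ := by
  simpa using (isImpulseResponse_impulse hP).hasLaurent.summable_norm

/-! ### Transfer functions without poles on the unit circle -/

theorem mem_tfF_of_denom_dvd {P : RatFunc ℝ} {q : Polynomial ℝ} (h : P.denom ∣ q)
    (hq : ∀ z : ℂ, ‖z‖ = 1 → q.eval₂ (algebraMap ℝ ℂ) z ≠ 0) : P ∈ tfF :=
  fun z hz h0 => hq z hz (Polynomial.eval₂_eq_zero_of_dvd_of_eval₂_eq_zero _ z h h0)

theorem algebraMap_mem_tfF (p : Polynomial ℝ) :
    algebraMap (Polynomial ℝ) (RatFunc ℝ) p ∈ tfF := by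
  intro z _
  simp

theorem mul_mem_tfF {P Q : RatFunc ℝ} (hP : P ∈ tfF) (hQ : Q ∈ tfF) : P * Q ∈ tfF :=
  mem_tfF_of_denom_dvd (RatFunc.denom_mul_dvd P Q) fun z hz => by
    rw [Polynomial.eval₂_mul]
    exact mul_ne_zero (hP z hz) (hQ z hz)

/-- The ring `𝓕` of real-rational functions without poles on the unit circle. -/
def tfRing : Subring (RatFunc ℝ) where
  carrier := tfF
  mul_mem' := mul_mem_tfF
  one_mem' := by simpa using algebraMap_mem_tfF 1
  add_mem' {P Q} hP hQ := mem_tfF_of_denom_dvd (RatFunc.denom_add_dvd P Q) fun z hz => by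
    rw [Polynomial.eval₂_mul]
    exact mul_ne_zero (hP z hz) (hQ z hz)
  zero_mem' := by simpa using algebraMap_mem_tfF 0
  neg_mem' {P} hP := by simpa using mul_mem_tfF (algebraMap_mem_tfF (-1)) hP

/-- Evaluation of transfer functions at a point of the unit circle. -/
def tfEvalHom (z : ℂ) (hz : ‖z‖ = 1) : tfRing →+* ℂ where
  toFun P := tfEval P z
  map_one' := RatFunc.eval_one _ _
  map_mul' P Q := RatFunc.eval_mul _ _ (P.2 z hz) (Q.2 z hz)
  map_zero' := RatFunc.eval_zero _ _
  map_add' P Q := RatFunc.eval_add _ _ (P.2 z hz) (Q.2 z hz)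

/-- The impulse response as a homomorphism on the ring of transfer functions. -/
def resp : tfRing →+ (ℤ → ℝ) :=
  AddMonoidHom.mk' (fun P => impulse P) fun P Q =>
    IsImpulseResponse.impulse_eq (P + Q).2 fun z hz => by
      have h := (isImpulseResponse_impulse P.2 z hz).add (isImpulseResponse_impulse Q.2 z hz)
      rw [show tfEval (P + Q : tfRing) z = tfEval P z + tfEval Q z from
        map_add (tfEvalHom z hz) P Q]
      simpa [add_mul] using h

theorem hasSum_resp (P : tfRing) (z : ℂ) (hz : ‖z‖ = 1) :
    HasSum (fun k : ℤ => (resp P k : ℂ) * z ^ (-k)) (tfEvalHom z hz P) :=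
  isImpulseResponse_impulse P.2 z hz

theorem summable_norm_resp (P : tfRing) : Summable fun k => ‖resp P k‖ :=
  summable_norm_impulse P.2

theorem resp_eq_of_hasSum {P : tfRing} {p : ℤ → ℝ}
    (h : ∀ (z : ℂ) (hz : ‖z‖ = 1),
      HasSum (fun k : ℤ => (p k : ℂ) * z ^ (-k)) (tfEvalHom z hz P)) : resp P = p :=
  IsImpulseResponse.impulse_eq P.2 h

theorem resp_mul (P Q : tfRing) :
    resp (P * Q) = fun n => ∑' k, resp P k * resp Q (n - k) := by
  refine resp_eq_of_hasSum fun z hz => ?_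
  rw [map_mul]
  convert! HasLaurent.mul (isImpulseResponse_impulse P.2).hasLaurent
    (isImpulseResponse_impulse Q.2).hasLaurent z hz using 1
  ext n
  push_cast
  rfl

/-- The transfer function of a polynomial in the forward shift `z`. -/
def polyTF : Polynomial ℝ →+* tfRing :=
  (algebraMap (Polynomial ℝ) (RatFunc ℝ)).codRestrict tfRing algebraMap_mem_tfF

@[simp]
theorem coe_polyTF (p : Polynomial ℝ) :
    (polyTF p : RatFunc ℝ) = algebraMap (Polynomial ℝ) (RatFunc ℝ) p := rfl

theorem tfEvalHom_polyTF (z : ℂ) (hz : ‖z‖ = 1) (p : Polynomial ℝ) :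
    tfEvalHom z hz (polyTF p) = p.eval₂ (algebraMap ℝ ℂ) z := by
  simp [tfEvalHom, tfEval, RatFunc.eval]

theorem resp_polyTF_monomial (n : ℕ) (a : ℝ) :
    resp (polyTF (Polynomial.monomial n a)) = fun k : ℤ => if k = -n then a else 0 := by
  refine resp_eq_of_hasSum fun z hz => ?_
  rw [tfEvalHom_polyTF]
  convert! hasLaurent_zpow (a : ℂ) (-n) z hz using 1
  · ext k
    split_ifs with hk <;> simp [hk]
  · simp

theorem resp_polyTF (p : Polynomial ℝ) (k : ℤ) :
    resp (polyTF p) k = if k ≤ 0 then p.coeff (-k).toNat else 0 := by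
  induction p using Polynomial.induction_on' with
  | add p q hp hq =>
    rw [map_add, map_add, Pi.add_apply, hp, hq]
    split_ifs <;> simp
  | monomial n a =>
    rw [resp_polyTF_monomial, Polynomial.coeff_monomial]
    split_ifs <;> first | rfl | lia

theorem resp_one (k : ℤ) : resp 1 k = if k = 0 then 1 else 0 := by
  simpa using congrFun (resp_polyTF_monomial 0 1) k

theorem polyTF_denom_mul (P : tfRing) :
    polyTF (P : RatFunc ℝ).denom * P = polyTF (P : RatFunc ℝ).num := by
  refine Subtype.ext ?_
  have h0 : algebraMap (Polynomial ℝ) (RatFunc ℝ) (P : RatFunc ℝ).denom ≠ 0 :=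
    RatFunc.algebraMap_ne_zero (RatFunc.denom_ne_zero _)
  rw [Subring.coe_mul, coe_polyTF, coe_polyTF, mul_comm, ← eq_div_iff h0, RatFunc.num_div_denom]

theorem isUnit_of_tfEvalHom_ne_zero {P : tfRing}
    (h : ∀ (z : ℂ) (hz : ‖z‖ = 1), tfEvalHom z hz P ≠ 0) : IsUnit P := by
  have h0 : (P : RatFunc ℝ) ≠ 0 := fun h0 =>
    h 1 norm_one (by rw [show P = 0 from Subtype.ext h0, map_zero])
  have hinv : (P : RatFunc ℝ)⁻¹ ∈ tfRing :=
    mem_tfF_of_denom_dvd (RatFunc.denom_inv_dvd h0) fun z hz hnum => h z hz <|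
      show tfEval P z = 0 by rw [tfEval, RatFunc.eval, hnum, zero_div]
  exact IsUnit.of_mul_eq_one ⟨_, hinv⟩ (Subtype.ext (mul_inv_cancel₀ h0))

theorem isUnit_polyTF_denom (P : tfRing) : IsUnit (polyTF (P : RatFunc ℝ).denom) :=
  isUnit_of_tfEvalHom_ne_zero fun z hz => by
    rw [tfEvalHom_polyTF]
    exact P.2 z hz

theorem exists_common_denom {ι : Type*} [Finite ι] (f : ι → tfRing) :
    ∃ D : Polynomial ℝ, IsUnit (polyTF D) ∧ ∀ i, ∃ n : Polynomial ℝ, polyTF D * f i = polyTF n := by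
  have := Fintype.ofFinite ι
  refine ⟨∏ i, (f i : RatFunc ℝ).denom, ?_, fun i => ?_⟩
  · rw [map_prod]
    exact Submonoid.prod_mem (IsUnit.submonoid tfRing) fun i _ => isUnit_polyTF_denom (f i)
  · obtain ⟨g, hg⟩ := Finset.dvd_prod_of_mem (fun i => (f i : RatFunc ℝ).denom) (Finset.mem_univ i)
    refine ⟨g * (f i : RatFunc ℝ).num, ?_⟩
    rw [hg, map_mul, map_mul, ← polyTF_denom_mul]
    ring

theorem infinite_setOf_norm_eq_one : {z : ℂ | ‖z‖ = 1}.Infinite := by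
  have : (Metric.sphere (0 : ℂ) 1).Infinite := by
    refine (isPreconnected_sphere (by simp [Complex.rank_real_complex]) _
      _).infinite_of_nontrivial ⟨1, by simp, -1, by simp, fun h => ?_⟩
    norm_num [Complex.ext_iff] at h
  simpa [Metric.sphere, dist_eq_norm] using this

theorem resp_injective : Function.Injective resp := by
  refine (injective_iff_map_eq_zero resp).2 fun P hP => ?_
  have heval (z : ℂ) (hz : ‖z‖ = 1) : (P : RatFunc ℝ).num.eval₂ (algebraMap ℝ ℂ) z = 0 := by
    have h := hasSum_resp P z hz
    simp only [hP, Pi.zero_apply, Complex.ofReal_zero, zero_mul] at h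
    rw [← tfEvalHom_polyTF z hz, ← polyTF_denom_mul, map_mul, h.unique hasSum_zero, mul_zero]
  have hnum : (P : RatFunc ℝ).num.map (algebraMap ℝ ℂ) = 0 :=
    Polynomial.eq_zero_of_infinite_isRoot _ (infinite_setOf_norm_eq_one.mono fun z hz => by
      rw [Set.mem_ofPred_eq, Polynomial.IsRoot, Polynomial.eval_map]
      exact heval z hz)
  exact Subtype.ext <|
    RatFunc.num_eq_zero_iff.1 ((Polynomial.map_eq_zero_iff (algebraMap ℝ ℂ).injective).1 hnum)

/-- The transfer function `z⁻¹`. -/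
def backShift : tfRing :=
  ⟨RatFunc.X⁻¹, mem_tfF_of_denom_dvd (q := Polynomial.X)
    (by simpa using RatFunc.denom_inv_dvd (K := ℝ) RatFunc.X_ne_zero)
    fun z hz => by simpa using ne_zero_of_norm_eq_one hz⟩

theorem tfEvalHom_backShift (z : ℂ) (hz : ‖z‖ = 1) : tfEvalHom z hz backShift = z⁻¹ := by
  have h : polyTF Polynomial.X * backShift = 1 := Subtype.ext (by
    simp [backShift, RatFunc.algebraMap_X, RatFunc.X_ne_zero])
  have hmul := congrArg (tfEvalHom z hz) h
  rw [map_mul, tfEvalHom_polyTF, Polynomial.eval₂_X, map_one] at hmul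
  exact eq_inv_of_mul_eq_one_right hmul

/-- The transfer function of a polynomial in the backward shift `z⁻¹`. -/
def backPolyTF : Polynomial ℝ →+* tfRing :=
  Polynomial.eval₂RingHom (polyTF.comp Polynomial.C) backShift

theorem tfEvalHom_backPolyTF (z : ℂ) (hz : ‖z‖ = 1) (p : Polynomial ℝ) :
    tfEvalHom z hz (backPolyTF p) = p.eval₂ (algebraMap ℝ ℂ) z⁻¹ := by
  rw [backPolyTF, Polynomial.coe_eval₂RingHom, Polynomial.hom_eval₂, tfEvalHom_backShift]
  congr 1
  ext x
  rw [RingHom.comp_apply, RingHom.comp_apply, tfEvalHom_polyTF, Polynomial.eval₂_C]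

theorem exists_resp_eq_neg (P : tfRing) : ∃ R : tfRing, ∀ k, resp R k = resp P (-k) := by
  have hnorm {z : ℂ} (hz : ‖z‖ = 1) : ‖z⁻¹‖ = 1 := by simp [hz]
  obtain ⟨v, hv⟩ : IsUnit (backPolyTF (P : RatFunc ℝ).denom) :=
    isUnit_of_tfEvalHom_ne_zero fun z hz => by
      rw [tfEvalHom_backPolyTF]
      exact P.2 _ (hnorm hz)
  refine ⟨backPolyTF (P : RatFunc ℝ).num * ↑v⁻¹, fun k => ?_⟩
  refine congrFun (resp_eq_of_hasSum (p := fun k => resp P (-k)) fun z hz => ?_) k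
  have hsum := hasSum_resp P z⁻¹ (hnorm hz)
  rw [← (Equiv.neg ℤ).hasSum_iff] at hsum
  convert! hsum using 1
  · ext k
    simp
  · have hcancel := congrArg (tfEvalHom z hz) v.mul_inv
    rw [map_mul, hv, map_one] at hcancel
    rw [map_mul, tfEvalHom_backPolyTF, ← tfEvalHom_polyTF z⁻¹ (hnorm hz), ← polyTF_denom_mul,
      map_mul, tfEvalHom_polyTF, ← tfEvalHom_backPolyTF z hz, mul_right_comm, hcancel, one_mul]

/-- The transfer functions whose impulse response is supported in `K`. Taking `K = ⊤` gives all
of `𝓕`, and the nonnegative times give the causal transfer functions `𝓕⁺`. -/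
def supportedRing (K : AddSubmonoid ℤ) : Subring tfRing where
  carrier := {P | ∀ k ∉ K, resp P k = 0}
  mul_mem' {P Q} hP hQ k hk := by
    rw [resp_mul]
    refine (tsum_congr fun j => ?_).trans tsum_zero
    by_cases hj : j ∈ K
    · have hkj : k - j ∉ K := fun hkj => hk (by simpa using K.add_mem hj hkj)
      rw [hQ _ hkj, mul_zero]
    · rw [hP j hj, zero_mul]
  one_mem' k hk := by rw [resp_one, if_neg fun h : k = 0 => hk (h ▸ K.zero_mem)]
  add_mem' {P Q} hP hQ k hk := by rw [map_add, Pi.add_apply, hP k hk, hQ k hk, add_zero]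
  zero_mem' k _ := by rw [map_zero, Pi.zero_apply]
  neg_mem' {P} hP k hk := by rw [map_neg, Pi.neg_apply, hP k hk, neg_zero]

/-- The rational functions in a ring of transfer functions, in the form in which the classes
`tfF` and `tfFplus` are given. -/
def tfClass (T : Subring tfRing) : Set (RatFunc ℝ) := Subtype.val '' (T : Set tfRing)

theorem coe_mem_tfClass {T : Subring tfRing} {P : tfRing} : (P : RatFunc ℝ) ∈ tfClass T ↔ P ∈ T :=
  Subtype.val_injective.mem_set_image

theorem exists_matrix_lift {T : Subring tfRing} {κ ι : Type*} {W : Matrix κ ι (RatFunc ℝ)}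
    (hW : ∀ a b, W a b ∈ tfClass T) :
    ∃ w : Matrix κ ι T, ∀ a b, ((w a b : tfRing) : RatFunc ℝ) = W a b := by
  choose w hwT hw using hW
  exact ⟨fun a b => ⟨w a b, hwT a b⟩, hw⟩

theorem tfClass_subset_tfF (T : Subring tfRing) : tfClass T ⊆ tfF := by
  rintro _ ⟨P, -, rfl⟩
  exact P.2

theorem tfClass_supportedRing_top : tfClass (supportedRing ⊤) = tfF :=
  (tfClass_subset_tfF _).antisymm fun P hP =>
    ⟨⟨P, hP⟩, fun k hk => (hk (AddSubmonoid.mem_top k)).elim, rfl⟩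

theorem tfClass_supportedRing_nonneg :
    tfClass (supportedRing (AddSubmonoid.nonneg ℤ)) = tfFplus := by
  ext P
  constructor
  · rintro ⟨P, hP, rfl⟩
    exact ⟨P.2, fun k hk => hP k fun h => hk.not_ge (AddSubmonoid.mem_nonneg.1 h)⟩
  · rintro ⟨hP, hcausal⟩
    exact ⟨⟨P, hP⟩, fun k hk => hcausal k (not_le.1 fun h => hk (AddSubmonoid.mem_nonneg.2 h)), rfl⟩

/-! ### Filters acting on bounded sequences -/

section Filters

variable {H : Type*} [NormedAddCommGroup H] [NormedSpace ℝ H]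

/-- Delay of a bounded sequence by `k` steps. -/
def delay (k : ℤ) : (ℤ →ᵇ H) →L[ℝ] (ℤ →ᵇ H) :=
  LinearMap.mkContinuous
    { toFun := fun x => x.compContinuous ⟨fun t => t - k, by fun_prop⟩
      map_add' := fun _ _ => rfl
      map_smul' := fun _ _ => rfl } 1
    fun x => by
      rw [one_mul]
      exact (BoundedContinuousFunction.norm_le (norm_nonneg _)).2 fun t => x.norm_coe_le_norm _

@[simp]
theorem delay_apply (k : ℤ) (x : ℤ →ᵇ H) (t : ℤ) : delay k x t = x (t - k) := rfl

theorem norm_delay_le (k : ℤ) : ‖(delay k : (ℤ →ᵇ H) →L[ℝ] (ℤ →ᵇ H))‖ ≤ 1 :=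
  LinearMap.mkContinuous_norm_le _ zero_le_one _

theorem delay_add (a b : ℤ) :
    (delay (a + b) : (ℤ →ᵇ H) →L[ℝ] (ℤ →ᵇ H)) = delay a * delay b := by
  ext x t
  simp [sub_sub]

variable [CompleteSpace H]

theorem summable_resp_smul_delay (P : tfRing) :
    Summable fun k => resp P k • (delay k : (ℤ →ᵇ H) →L[ℝ] (ℤ →ᵇ H)) :=
  (summable_norm_smul_of_norm_le_one norm_delay_le (summable_norm_resp P)).of_norm

variable (H) in
/-- Transfer functions as convolution operators on bounded sequences. -/
def convHom : tfRing →+* ((ℤ →ᵇ H) →L[ℝ] (ℤ →ᵇ H)) where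
  toFun P := ∑' k, resp P k • delay k
  map_one' := by
    rw [tsum_eq_single 0 fun k hk => by rw [resp_one, if_neg hk, zero_smul]]
    rw [resp_one, if_pos rfl, one_smul]
    ext x t
    simp
  map_zero' := by simp
  map_add' P Q := by
    simp only [map_add, Pi.add_apply, add_smul]
    exact (summable_resp_smul_delay P).tsum_add (summable_resp_smul_delay Q)
  map_mul' P Q := by
    simp only [resp_mul]
    exact (hasSum_conv_smul (B := (ℤ →ᵇ H) →L[ℝ] (ℤ →ᵇ H)) (S := delay) delay_add norm_delay_le
      (summable_norm_resp P) (summable_norm_resp Q)).tsum_eq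

instance : Module tfRing (ℤ →ᵇ H) := Module.compHom _ (convHom H)

theorem hasSum_tf_smul_apply (P : tfRing) (x : ℤ →ᵇ H) (t : ℤ) :
    HasSum (fun k => resp P k • x (t - k)) ((P • x) t) :=
  ((summable_resp_smul_delay P).hasSum.mapL
    (ContinuousLinearMap.apply ℝ (ℤ →ᵇ H) x)).mapL (BoundedContinuousFunction.evalCLM ℝ t)

theorem tf_smul_apply (P : tfRing) (x : ℤ →ᵇ H) (t : ℤ) :
    (P • x) t = ∑' k, resp P k • x (t - k) :=
  (hasSum_tf_smul_apply P x t).tsum_eq.symm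

theorem hasSum_tf_smul_apply_sub (P : tfRing) (x : ℤ →ᵇ H) (t : ℤ) :
    HasSum (fun k => resp P (t - k) • x k) ((P • x) t) := by
  have h := hasSum_tf_smul_apply P x t
  rw [← (Equiv.subLeft t).hasSum_iff] at h
  simpa [Function.comp_def] using h

theorem tf_smul_delay (P : tfRing) (k : ℤ) (x : ℤ →ᵇ H) : P • delay k x = delay k (P • x) := by
  ext t
  rw [delay_apply, tf_smul_apply, tf_smul_apply]
  simp only [delay_apply, sub_right_comm]

theorem tf_smul_apply_eq_zero {P : tfRing} {x : ℤ →ᵇ H} {t : ℤ}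
    (h : ∀ k, resp P k = 0 ∨ x (t - k) = 0) : (P • x) t = 0 := by
  rw [tf_smul_apply]
  exact (tsum_congr fun k => smul_eq_zero.2 (h k)).trans tsum_zero

theorem resp_polyTF_eq_zero {p : Polynomial ℝ} {k : ℤ} (h : 0 < k ∨ k < -p.natDegree) :
    resp (polyTF p) k = 0 := by
  rw [resp_polyTF]
  split_ifs with hk
  · exact Polynomial.coeff_eq_zero_of_natDegree_lt (by lia)
  · rfl

theorem polyTF_smul_apply_eq_zero_of_le (p : Polynomial ℝ) {x : ℤ →ᵇ H} {n : ℤ}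
    (hx : ∀ k, n ≤ k → x k = 0) {k : ℤ} (hk : n ≤ k) : (polyTF p • x) k = 0 :=
  tf_smul_apply_eq_zero fun j => (lt_or_ge 0 j).imp (fun hj => resp_polyTF_eq_zero (.inl hj))
    fun _ => hx _ (by lia)

theorem polyTF_smul_apply_eq_zero_of_lt (p : Polynomial ℝ) {x : ℤ →ᵇ H}
    (hx : ∀ k < 0, x k = 0) {k : ℤ} (hk : k < -p.natDegree) : (polyTF p • x) k = 0 :=
  tf_smul_apply_eq_zero fun j => (lt_or_ge j (-p.natDegree)).imp
    (fun hj => resp_polyTF_eq_zero (.inr hj)) fun _ => hx _ (by lia)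

end Filters

/-- The unit impulse at time `0`. -/
def unitImpulse : ℤ →ᵇ ℝ :=
  BoundedContinuousFunction.ofNormedAddCommGroupDiscrete (fun k => if k = 0 then 1 else 0) 1
    fun k => by split_ifs <;> simp

theorem unitImpulse_apply (k : ℤ) : unitImpulse k = if k = 0 then 1 else 0 := rfl

theorem tf_smul_unitImpulse (P : tfRing) (k : ℤ) : (P • unitImpulse) k = resp P k := by
  rw [tf_smul_apply, tsum_eq_single k]
  · simp [unitImpulse_apply]
  · intro j hj
    rw [unitImpulse_apply, if_neg (by lia), smul_zero]

theorem exists_eq_polyTF_smul_unitImpulse {x : ℤ →ᵇ ℝ} {n : ℕ} (hpos : ∀ k, 1 ≤ k → x k = 0)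
    (hneg : ∀ k : ℤ, k < -n → x k = 0) : ∃ p : Polynomial ℝ, x = polyTF p • unitImpulse := by
  refine ⟨∑ i ∈ Finset.range (n + 1), Polynomial.monomial i (x (-i)), ?_⟩
  ext k
  rw [tf_smul_unitImpulse, resp_polyTF]
  split_ifs with hk
  · rw [Polynomial.finsetSum_coeff]
    simp only [Polynomial.coeff_monomial, Finset.sum_ite_eq', Finset.mem_range]
    split_ifs with hn
    · congr 1
      lia
    · exact hneg _ (by lia)
  · exact hpos _ (by lia)

/-! ### Separating partitions -/

/-- `K` and `J` are separated along the relation `r` by `Z = ZK ∪ ZJ`: the predecessors of the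
side `K ∪ ZK` lie in `K ∪ Z`, and those of the side `J ∪ ZJ` lie in `J ∪ Z`. -/
structure IsSeparation {C : Type*} (r : C → C → Prop) (K J ZK ZJ : Set C) : Prop where
  disjoint : Disjoint K J
  disjoint_left : Disjoint K (ZK ∪ ZJ)
  disjoint_right : Disjoint J (ZK ∪ ZJ)
  disjoint_separator : Disjoint ZK ZJ
  pred_left : ∀ c ∈ K ∪ ZK, ∀ b, r b c → b ∈ K ∪ (ZK ∪ ZJ)
  pred_right : ∀ c ∈ J ∪ ZJ, ∀ b, r b c → b ∈ J ∪ (ZK ∪ ZJ)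

theorem IsSeparation.symm {C : Type*} {r : C → C → Prop} {K J ZK ZJ : Set C}
    (h : IsSeparation r K J ZK ZJ) : IsSeparation r J K ZJ ZK where
  disjoint := h.disjoint.symm
  disjoint_left := by simpa only [Set.union_comm] using h.disjoint_right
  disjoint_right := by simpa only [Set.union_comm] using h.disjoint_left
  disjoint_separator := h.disjoint_separator.symm
  pred_left := by simpa only [Set.union_comm ZJ ZK] using h.pred_right
  pred_right := by simpa only [Set.union_comm ZJ ZK] using h.pred_left

theorem IsSeparation.comap {C V : Type*} {r : V → V → Prop} {r' : C → C → Prop}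
    {K J ZK ZJ : Set V} (h : IsSeparation r K J ZK ZJ) (f : C → V)
    (hr : ∀ b c, r' b c → r (f b) (f c)) :
    IsSeparation r' (f ⁻¹' K) (f ⁻¹' J) (f ⁻¹' ZK) (f ⁻¹' ZJ) where
  disjoint := h.disjoint.preimage f
  disjoint_left := h.disjoint_left.preimage f
  disjoint_right := h.disjoint_right.preimage f
  disjoint_separator := h.disjoint_separator.preimage f
  pred_left c hc b hbc := h.pred_left (f c) hc (f b) (hr b c hbc)
  pred_right c hc b hbc := h.pred_right (f c) hc (f b) (hr b c hbc)

theorem IsSeparation.disjoint_union {C : Type*} {r : C → C → Prop} {K J ZK ZJ : Set C}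
    (h : IsSeparation r K J ZK ZJ) : Disjoint (K ∪ ZK) (J ∪ ZJ) :=
  Set.disjoint_union_left.2
    ⟨Set.disjoint_union_right.2 ⟨h.disjoint, h.disjoint_left.mono_right Set.subset_union_right⟩,
      Set.disjoint_union_right.2
        ⟨(h.disjoint_right.mono_right Set.subset_union_left).symm, h.disjoint_separator⟩⟩

section DSeparation

variable {V : Type*} {G : Digraph V}

/-- `v` has a descendant in `S`. -/
def IsAncestorOf (G : Digraph V) (S : Set V) (v : V) : Prop := ∃ w ∈ S, IsDescendant G v w

/-- The arrow `v → w` if the flag is `true`, and `v ← w` if it is `false`. -/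
def Arrow (G : Digraph V) : Bool → V → V → Prop
  | true, v, w => G.Adj v w
  | false, v, w => G.Adj w v

/-- The interior node `v` of a walk, entered and left along arrows with the given flags, does not
block the walk given `Z`. -/
def Passes (G : Digraph V) (Z : Set V) : Bool → Bool → V → Prop
  | true, false, v => IsAncestorOf G Z v
  | _, _, v => v ∉ Z

namespace IsAncestorOf

variable {S : Set V} {v w : V}

theorem of_mem (h : v ∈ S) : IsAncestorOf G S v := ⟨v, h, Relation.ReflTransGen.refl⟩

theorem of_isDescendant (h : IsDescendant G v w) : IsAncestorOf G S w → IsAncestorOf G S v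
  | ⟨x, hx, hwx⟩ => ⟨x, hx, h.trans hwx⟩

theorem of_adj (h : G.Adj v w) : IsAncestorOf G S w → IsAncestorOf G S v :=
  of_isDescendant (Relation.ReflTransGen.single h)

end IsAncestorOf

namespace Passes

variable {Z : Set V} {r s r' s' : Bool} {v : V}

theorem of_notMem (h : v ∉ Z) (hr : ¬ (r = true ∧ s = false)) : Passes G Z r s v := by
  cases r <;> cases s <;> first | exact h | exact (hr ⟨rfl, rfl⟩).elim

theorem notMem (h : Passes G Z r s v) (hr : ¬ (r = true ∧ s = false)) : v ∉ Z := by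
  cases r <;> cases s <;> first | exact h | exact (hr ⟨rfl, rfl⟩).elim

theorem splice (hin : Passes G Z r s v) (hout : Passes G Z r' s' v)
    (hloop : s = true → IsAncestorOf G Z v ∨ r' = true) : Passes G Z r s' v := by
  by_cases hcol : r = true ∧ s' = false
  · obtain ⟨rfl, rfl⟩ := hcol
    cases s with
    | false => exact hin
    | true =>
      rcases hloop rfl with hanc | rfl
      · exact hanc
      · exact hout
  · by_cases hrs : r = true ∧ s = false
    · exact of_notMem (hout.notMem fun h => hcol ⟨hrs.1, h.2⟩) hcol
    · exact of_notMem (hin.notMem hrs) hcol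

end Passes

/-- Walks with `n` arrows none of whose interior nodes blocks given `Z`. -/
structure IsActiveWalk (G : Digraph V) (Z : Set V) (n : ℕ) (node : ℕ → V) (right : ℕ → Bool) :
    Prop where
  arrow : ∀ p < n, Arrow G (right p) (node p) (node (p + 1))
  passes : ∀ p, p + 1 < n → Passes G Z (right p) (right (p + 1)) (node (p + 1))

namespace IsActiveWalk

variable {Z : Set V} {n : ℕ} {node : ℕ → V} {right : ℕ → Bool}

theorem extend (h : IsActiveWalk G Z n node right) {w : V} {r : Bool} (hw : Arrow G r (node n) w)
    (hn : ∀ k, n = k + 1 → Passes G Z (right k) r (node n)) :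
    IsActiveWalk G Z (n + 1) (fun p => if p ≤ n then node p else w)
      (fun p => if p < n then right p else r) := by
  refine ⟨fun p hp => ?_, fun p hp => ?_⟩
  · rcases Nat.lt_succ_iff_lt_or_eq.1 hp with hp | rfl
    · simpa only [hp, hp.le, Nat.succ_le_of_lt hp, if_true] using h.arrow p hp
    · simpa using hw
  · rcases Nat.lt_succ_iff_lt_or_eq.1 hp with hp | rfl
    · have hpn : p < n := by lia
      simpa only [hp, hp.le, hpn, if_true] using h.passes p hp
    · simpa using hn p rfl

theorem isAncestorOf_or_isDescendant (h : IsActiveWalk G Z n node right) {p : ℕ}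
    (hp : right p = true) {q : ℕ} (hpq : p ≤ q) (hq : q < n) :
    IsAncestorOf G Z (node p) ∨ (right q = true ∧ IsDescendant G (node p) (node (q + 1))) := by
  induction q, hpq using Nat.le_induction with
  | base =>
    have harrow := h.arrow p hq
    rw [hp] at harrow
    exact Or.inr ⟨hp, Relation.ReflTransGen.single harrow⟩
  | succ q _ ih =>
    rcases ih (by lia) with ih | ⟨hq_right, hdesc⟩
    · exact Or.inl ih
    · have harrow := h.arrow (q + 1) hq
      have hpass := h.passes q hq
      rw [hq_right] at hpass
      cases hr : right (q + 1) with
      | true => exact Or.inr ⟨rfl, hdesc.tail (by rwa [hr] at harrow)⟩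
      | false => exact Or.inl (.of_isDescendant hdesc (by rwa [hr] at hpass))

theorem shortcut (h : IsActiveWalk G Z n node right) {p k : ℕ} (hk : 0 < k) (hpk : p + k ≤ n)
    (heq : node p = node (p + k)) :
    IsActiveWalk G Z (n - k) (fun m => if m ≤ p then node m else node (m + k))
      (fun m => if m < p then right m else right (m + k)) := by
  have hnode {m : ℕ} (hm : p ≤ m) : (if m ≤ p then node m else node (m + k)) = node (m + k) := by
    rcases hm.eq_or_lt with rfl | hm
    · rw [if_pos le_rfl, heq]
    · rw [if_neg hm.not_ge]
  refine ⟨fun m hm => ?_, fun m hm => ?_⟩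
  · rcases lt_or_ge m p with hmp | hmp
    · simpa only [hmp, hmp.le, Nat.succ_le_of_lt hmp, if_true] using h.arrow m (by lia)
    · rw [hnode hmp, hnode (by lia : p ≤ m + 1), if_neg hmp.not_gt, add_right_comm]
      exact h.arrow _ (by lia)
  · rcases lt_trichotomy (m + 1) p with hmp | rfl | hmp
    · have hmp' : m < p := by lia
      simpa only [hmp, hmp.le, hmp', if_true] using h.passes m (by lia)
    · obtain ⟨l, rfl⟩ : ∃ l, k = l + 1 := ⟨k - 1, by lia⟩
      have hout := h.passes (m + 1 + l) (by lia)
      rw [show m + 1 + l + 1 = m + 1 + (l + 1) from rfl, ← heq] at hout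
      rw [if_pos (Nat.lt_succ_self m), if_neg (lt_irrefl _), if_pos le_rfl]
      exact (h.passes m (by lia)).splice hout fun hr =>
        (h.isAncestorOf_or_isDescendant hr (by lia) (by lia)).imp_right And.left
    · rw [hnode hmp.le, if_neg (by lia : ¬ m < p), if_neg hmp.not_gt, add_right_comm]
      exact h.passes _ (by lia)

end IsActiveWalk

theorem exists_not_blocked_of_isActiveWalk {Z : Finset V} {i j : V} (hi : i ∉ Z) (hj : j ∉ Z)
    (h : ∃ n node right, IsActiveWalk G Z n node right ∧ node 0 = i ∧ node n = j) :
    ∃ π : DiPath G i j, ¬ π.Blocked Z := by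
  classical
  -- A shortest active walk visits each of its nodes once.
  obtain ⟨node, right, hw, h0, hn⟩ := Nat.find_spec h
  set n := Nat.find h
  have hinj (p q : ℕ) (hpq : p < q) (hq : q ≤ n) : node p ≠ node q := by
    intro heq
    obtain ⟨k, rfl⟩ : ∃ k, q = p + k := ⟨q - p, by lia⟩
    refine Nat.find_min h (m := n - k) (by lia)
      ⟨_, _, hw.shortcut (p := p) (k := k) (by lia) hq heq, by simpa using h0, ?_⟩
    rcases eq_or_lt_of_le hq with hq' | hq'
    · rw [if_pos (by lia), show n - k = p by lia, heq, hq', hn]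
    · rw [if_neg (by lia), show n - k + k = n by lia, hn]
  refine ⟨⟨n, node, right, h0, hn, fun p hp hr => ?_, fun p hp hr => ?_, fun p q hpq hq heq =>
    hinj p q hpq hq.le (Prod.ext_iff.1 heq).1⟩, ?_⟩
  · have harrow := hw.arrow p hp
    rw [show right p = true from hr] at harrow
    exact harrow
  · have harrow := hw.arrow p hp
    rw [show right p = false from hr] at harrow
    exact harrow
  · rintro (⟨p, hp, hpZ, hcol⟩ | ⟨p, ⟨hp0, hpn, hr, hr'⟩, hdesc⟩)
    · rcases Nat.eq_zero_or_pos p with rfl | hp0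
      · exact hi (h0 ▸ hpZ)
      rcases eq_or_lt_of_le hp with rfl | hpn
      · exact hj (hn ▸ hpZ)
      obtain ⟨m, rfl⟩ : ∃ m, p = m + 1 := ⟨p - 1, by lia⟩
      exact (hw.passes m hpn).notMem (fun hm => hcol ⟨hp0, hpn, hm⟩) hpZ
    · obtain ⟨m, rfl⟩ : ∃ m, p = m + 1 := ⟨p - 1, by lia⟩
      have hpass := hw.passes m hpn
      rw [show right m = true from hr, show right (m + 1) = false from hr'] at hpass
      obtain ⟨w, hwZ, hw'⟩ := hpass
      exact hdesc w hw' hwZ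

/-- Nodes that can be reached from `I` along active walks. The flag is that of the last arrow; a
walk without arrows gets the flag `false`, for which leaving the node requires it to be outside
`Z`. -/
inductive ActiveReach (G : Digraph V) (I Z : Set V) : V → Bool → Prop
  | start {i : V} : i ∈ I → ActiveReach G I Z i false
  | step {v w : V} {r s : Bool} : ActiveReach G I Z v r → Passes G Z r s v → Arrow G s v w →
      ActiveReach G I Z w s

namespace ActiveReach

variable {I Z : Set V} {v w : V} {r : Bool}

theorem exists_isActiveWalk (h : ActiveReach G I Z v r) :
    ∃ n node right, IsActiveWalk G Z n node right ∧ node 0 ∈ I ∧ node n = v ∧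
      ∀ k, n = k + 1 → right k = r := by
  induction h with
  | @start i hi =>
    refine ⟨0, fun _ => i, fun _ => false, ⟨?_, ?_⟩, hi, rfl, ?_⟩ <;> intros <;> lia
  | step _ hpass harrow ih =>
    obtain ⟨n, node, right, hw, h0, rfl, hr⟩ := ih
    exact ⟨n + 1, _, _, hw.extend harrow fun k hk => (hr k hk).symm ▸ hpass, by simpa using h0,
      by simp, fun k hk => by simp [show k = n by lia]⟩

theorem child (h : ActiveReach G I Z v r) (hv : v ∉ Z) (hvw : G.Adj v w) :
    ActiveReach G I Z w true :=
  h.step (.of_notMem hv (by simp)) hvw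

theorem parent (h : ActiveReach G I Z v false) (hv : v ∉ Z) (hwv : G.Adj w v) :
    ActiveReach G I Z w false :=
  h.step (.of_notMem hv (by simp)) hwv

theorem collider (h : ActiveReach G I Z v true) (hv : IsAncestorOf G Z v) (hwv : G.Adj w v) :
    ActiveReach G I Z w false :=
  h.step hv hwv

theorem of_isDescendant_mem {i : V} (hi : i ∈ I) (h : IsDescendant G v i)
    (hv : ¬ IsAncestorOf G Z v) : ActiveReach G I Z v false := by
  induction h using Relation.ReflTransGen.head_induction_on with
  | refl => exact .start hi
  | @head v w hvw _ ih =>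
    have hw : ¬ IsAncestorOf G Z w := fun h => hv (.of_adj hvw h)
    exact (ih hw).parent (fun h => hw (.of_mem h)) hvw

theorem of_isDescendant (hr : ActiveReach G I Z v r) (h : IsDescendant G v w)
    (hv : ¬ IsAncestorOf G Z v) : ∃ s, ActiveReach G I Z w s := by
  induction h with
  | refl => exact ⟨r, hr⟩
  | @tail x w hvx hxw ih =>
    obtain ⟨s, hs⟩ := ih
    exact ⟨true, hs.child (fun h => hv (.of_isDescendant hvx (.of_mem h))) hxw⟩

end ActiveReach

namespace DSep

variable {I Z J : Finset V}

theorem not_activeReach (h : DSep G I Z J) (hIZ : Disjoint I Z) (hZJ : Disjoint Z J) {j : V}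
    (hj : j ∈ J) (r : Bool) : ¬ ActiveReach G I Z j r := by
  intro hr
  obtain ⟨n, node, right, hw, h0, hn, -⟩ := hr.exists_isActiveWalk
  obtain ⟨π, hπ⟩ := exists_not_blocked_of_isActiveWalk (Finset.disjoint_left.1 hIZ h0)
    (Finset.disjoint_right.1 hZJ hj) ⟨n, node, right, hw, rfl, hn⟩
  exact hπ (h _ h0 _ hj π)

theorem activeReach_parent (h : DSep G I Z J) (hIZ : Disjoint I Z) (hZJ : Disjoint Z J) {v w : V}
    {r : Bool} (hanc : IsAncestorOf G (I ∪ Z ∪ J : Set V) v) (hv : v ∉ Z)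
    (hr : ActiveReach G I Z v r) (hwv : G.Adj w v) : ActiveReach G I Z w false := by
  cases r with
  | false => exact hr.parent hv hwv
  | true =>
    by_cases hvZ : IsAncestorOf G (Z : Set V) v
    · exact hr.collider hvZ hwv
    · obtain ⟨x, (hx | hx) | hx, hvx⟩ := hanc
      · exact (ActiveReach.of_isDescendant_mem hx hvx hvZ).parent hv hwv
      · exact (hvZ ⟨x, hx, hvx⟩).elim
      · obtain ⟨s, hs⟩ := hr.of_isDescendant hvx hvZ
        exact (h.not_activeReach hIZ hZJ hx s hs).elim

/-- The two parts consist of the ancestors of `I ∪ Z ∪ J` outside `Z` that are, respectively are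
not, reached from `I` along active walks. -/
theorem exists_isSeparation (h : DSep G I Z J) (hIZ : Disjoint I Z) (hZJ : Disjoint Z J) :
    ∃ K L ZK ZL : Set V, IsSeparation G.Adj K L ZK ZL ∧ ZK ∪ ZL = Z ∧ (I : Set V) ⊆ K ∧
      (J : Set V) ⊆ L := by
  set A : Set V := {v | IsAncestorOf G (I ∪ Z ∪ J : Set V) v}
  set R : Set V := {v | ∃ r, ActiveReach G I Z v r}
  set ZK : Set V := {z ∈ (Z : Set V) | ∀ w ∈ (A \ Z) \ R, ¬ G.Adj w z}
  have hZ : ZK ∪ (Z \ ZK) = (Z : Set V) := Set.union_sdiff_cancel (Set.sep_subset _ _)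
  have hsub {v : V} (hv : v ∈ (I ∪ Z ∪ J : Set V)) : v ∈ A := .of_mem hv
  have hpred {b c : V} (hbc : G.Adj b c) (hc : c ∈ A) : b ∈ A := .of_adj hbc hc
  refine ⟨(A \ Z) ∩ R, (A \ Z) \ R, ZK, Z \ ZK, ⟨?_, ?_, ?_, Set.disjoint_sdiff_right,
    fun c hc b hbc => ?_, fun c hc b hbc => ?_⟩, hZ, fun i hi => ?_, fun j hj => ?_⟩
  · exact Set.disjoint_sdiff_right.mono_left Set.inter_subset_right
  · rw [hZ]
    exact Set.disjoint_sdiff_left.mono_left Set.inter_subset_left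
  · rw [hZ]
    exact Set.disjoint_sdiff_left.mono_left Set.sdiff_subset
  · rw [hZ]
    by_cases hbZ : b ∈ (Z : Set V)
    · exact .inr hbZ
    rcases hc with ⟨⟨hcA, hcZ⟩, r, hr⟩ | ⟨hcZ, hcL⟩
    · exact .inl ⟨⟨hpred hbc hcA, hbZ⟩, false, h.activeReach_parent hIZ hZJ hcA hcZ hr hbc⟩
    · have hbA := hpred hbc (hsub (.inl (.inr hcZ)))
      exact .inl ⟨⟨hbA, hbZ⟩, by_contra fun hbR => hcL b ⟨⟨hbA, hbZ⟩, hbR⟩ hbc⟩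
  · rw [hZ]
    by_cases hbZ : b ∈ (Z : Set V)
    · exact .inr hbZ
    rcases hc with ⟨⟨hcA, _⟩, hcR⟩ | ⟨hcZ, hcK⟩
    · exact .inl ⟨⟨hpred hbc hcA, hbZ⟩, fun ⟨r, hr⟩ => hcR ⟨true, hr.child hbZ hbc⟩⟩
    · have hbA := hpred hbc (hsub (.inl (.inr hcZ)))
      obtain ⟨w, hw, hwc⟩ : ∃ w ∈ (A \ Z) \ R, G.Adj w c := by
        by_contra! hw
        exact hcK ⟨hcZ, hw⟩
      exact .inl ⟨⟨hbA, hbZ⟩, fun ⟨r, hr⟩ =>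
        hw.2 ⟨false, (hr.child hbZ hbc).collider (.of_mem hcZ) hwc⟩⟩
  · exact ⟨⟨hsub (.inl (.inl hi)), Finset.disjoint_left.1 hIZ hi⟩, false, .start hi⟩
  · exact ⟨⟨hsub (.inr hj), Finset.disjoint_right.1 hZJ hj⟩, fun ⟨r, hr⟩ =>
      h.not_activeReach hIZ hZJ hj r hr⟩

end DSep

end DSeparation

/-! ### Linear networks -/

section Network

open scoped Matrix.Module
open Submodule (span)

variable {C T M : Type*} [Fintype C] [DecidableEq C]

open Classical in
/-- The matrix `Q` with the entries outside of the block `S × S` replaced by `0`, so that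
`1 - block Q S` is invertible exactly if the submatrix of `1 - Q` on `S` is. -/
def block [Zero T] (Q : Matrix C C T) (S : Set C) : Matrix C C T :=
  Matrix.of fun a b => if a ∈ S ∧ b ∈ S then Q a b else 0

theorem isUnit_one_sub_block [CommRing T] {Q : Matrix C C T} {S : Set C} [DecidablePred (· ∈ S)]
    (h : IsUnit (1 - Q.submatrix (Subtype.val : S → C) (Subtype.val : S → C))) :
    IsUnit (1 - block Q S) := by
  rw [Matrix.isUnit_iff_isUnit_det] at h ⊢
  rw [Matrix.twoBlockTriangular_det _ (· ∈ S) fun a ha b _ => by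
    rw [Matrix.sub_apply, Matrix.one_apply_ne (by rintro rfl; contradiction)]
    simp [block, ha]]
  have hS : (1 - block Q S).toSquareBlockProp (· ∈ S) =
      1 - Q.submatrix (Subtype.val : S → C) (Subtype.val : S → C) := by
    ext a b
    simp [block, Matrix.toSquareBlockProp_def, Matrix.one_apply, Subtype.ext_iff]
  have hSc : (1 - block Q S).toSquareBlockProp (fun a => ¬ a ∈ S) = 1 := by
    ext a b
    simp [block, Matrix.toSquareBlockProp_def, Matrix.one_apply, Subtype.ext_iff, a.2]
  rw [hS, hSc, Matrix.det_one, mul_one]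
  convert h

variable [Ring T] [AddCommGroup M] [Module T M] {Q : Matrix C C T} {S : Set C}

theorem matrix_smul_mem (A : Matrix C C T) {x : C → M} {N : Submodule T M} (hx : ∀ c, x c ∈ N)
    (c : C) : (A • x) c ∈ N :=
  N.sum_mem fun b _ => N.smul_mem _ (hx b)

theorem block_smul_apply_of_mem (Q : Matrix C C T) {c : C} (hc : c ∈ S) (x : C → M) :
    (block Q S • x) c = (Q • S.indicator x) c := by
  classical
  simp only [Matrix.Module.smul_apply]
  refine Finset.sum_congr rfl fun b _ => ?_
  by_cases hb : b ∈ S <;> simp [block, hb, hc]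

theorem block_smul_apply_of_notMem (Q : Matrix C C T) {c : C} (hc : c ∉ S) (x : C → M) :
    (block Q S • x) c = 0 := by
  simp [block, hc]

theorem mem_of_sub_smul_mem (hQ : IsUnit (1 - block Q S)) {x : C → M} {N : Submodule T M}
    (hx : ∀ c ∈ S, x c - (Q • x) c ∈ N) (hQx : ∀ c ∈ S, ∀ b ∉ S, Q c b • x b ∈ N) {c : C}
    (hc : c ∈ S) : x c ∈ N := by
  obtain ⟨A, hA⟩ := hQ.exists_left_inv
  have hmem (c : C) : ((1 - block Q S) • S.indicator x) c ∈ N := by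
    rw [sub_smul, one_smul, Pi.sub_apply]
    by_cases hc : c ∈ S
    · have hsplit : S.indicator x c - (Q • S.indicator x) c =
          x c - (Q • x) c + (Q • (x - S.indicator x)) c := by
        rw [Set.indicator_of_mem hc, smul_sub, Pi.sub_apply]
        abel
      rw [block_smul_apply_of_mem Q hc, Set.indicator_indicator, Set.inter_self, hsplit]
      refine N.add_mem (hx c hc) (N.sum_mem fun b _ => ?_)
      by_cases hb : b ∈ S
      · simp [hb]
      · simpa [hb] using hQx c hc b hb
    · rw [block_smul_apply_of_notMem Q hc, Set.indicator_of_notMem hc, sub_zero]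
      exact N.zero_mem
  rw [← Set.indicator_of_mem hc x, ← one_smul (Matrix C C T) (S.indicator x), ← hA, mul_smul]
  exact matrix_smul_mem A hmem c

/-- The signals `η` by which the network `Q` responds to the inputs `e` on `S`, if all signals
outside of `S` are held at `0`. -/
structure IsResponse (Q : Matrix C C T) (S : Set C) (e η : C → M) : Prop where
  eq_zero : ∀ c ∉ S, η c = 0
  sub_smul : ∀ c ∈ S, η c - (Q • η) c = e c

theorem exists_isResponse (hQ : IsUnit (1 - block Q S)) (e : C → M) :
    ∃ η : C → M, IsResponse Q S e η := by
  obtain ⟨A, hA⟩ := hQ.exists_right_inv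
  have h (c : C) : ((1 - block Q S) • A • S.indicator e) c = S.indicator e c := by
    rw [← mul_smul, hA, one_smul]
  simp only [sub_smul, one_smul, Pi.sub_apply] at h
  have hzero (c : C) (hc : c ∉ S) : (A • S.indicator e) c = 0 := by
    simpa only [block_smul_apply_of_notMem Q hc, Set.indicator_of_notMem hc, sub_zero] using h c
  have hindicator : S.indicator (A • S.indicator e) = A • S.indicator e :=
    Set.indicator_eq_self.2 fun c hc => by_contra fun hcS => hc (hzero c hcS)
  refine ⟨A • S.indicator e, hzero, fun c hc => ?_⟩
  simpa only [block_smul_apply_of_mem Q hc, hindicator, Set.indicator_of_mem hc] using h c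

namespace IsResponse

variable {y e η : C → M}

theorem mem_span (h : IsResponse Q S e η) (hQ : IsUnit (1 - block Q S)) (c : C) :
    η c ∈ span T (e '' S) := by
  by_cases hc : c ∈ S
  · refine mem_of_sub_smul_mem hQ (fun c hc => ?_) (fun c _ b hb => ?_) hc
    · rw [h.sub_smul c hc]
      exact Submodule.subset_span ⟨c, hc, rfl⟩
    · rw [h.eq_zero b hb, smul_zero]
      exact Submodule.zero_mem _
  · rw [h.eq_zero c hc]
    exact Submodule.zero_mem _

theorem sub_mem_span (h : IsResponse Q S e η) (hQ : IsUnit (1 - block Q S)) (hy : y - Q • y = e)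
    {Z : Set C} (hZ : ∀ c ∈ S, ∀ b, Q c b ≠ 0 → b ∈ S ∪ Z) {c : C} (hc : c ∈ S) :
    (y - η) c ∈ span T (y '' Z) := by
  refine mem_of_sub_smul_mem hQ (fun c hc => ?_) (fun c hc b hb => ?_) hc
  · have hzero : (y - η) c - (Q • (y - η)) c = (y - Q • y) c - (η c - (Q • η) c) := by
      simp only [smul_sub, Pi.sub_apply]
      abel
    rw [hzero, hy, h.sub_smul c hc, sub_self]
    exact Submodule.zero_mem _
  · rw [Pi.sub_apply, h.eq_zero b hb, sub_zero]
    by_cases hcb : Q c b = 0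
    · rw [hcb, zero_smul]
      exact Submodule.zero_mem _
    · exact Submodule.smul_mem _ _
        (Submodule.subset_span ⟨b, (hZ c hc b hcb).resolve_left hb, rfl⟩)

end IsResponse

namespace IsSeparation

variable {K J ZK ZJ : Set C} {y e ηK ηJ : C → M}

theorem smul_response_apply_eq_zero (h : IsSeparation (fun b c => Q c b ≠ 0) K J ZK ZJ)
    (hJ : IsResponse Q J e ηJ) {c : C} (hc : c ∈ K ∪ ZK) : (Q • ηJ) c = 0 := by
  refine Finset.sum_eq_zero fun b _ => ?_
  by_cases hcb : Q c b = 0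
  · rw [hcb, zero_smul]
  · have hb : b ∉ J := by
      rcases h.pred_left c hc b hcb with hb | hb
      · exact h.disjoint.notMem_of_mem_left hb
      · exact h.disjoint_right.notMem_of_mem_right hb
    rw [hJ.eq_zero b hb, smul_zero]

theorem sub_sub_smul_eq (h : IsSeparation (fun b c => Q c b ≠ 0) K J ZK ZJ) (hy : y - Q • y = e)
    (hJ : IsResponse Q J e ηJ) {c : C} (hc : c ∈ K ∪ ZK) :
    (y - (ηK + ηJ)) c - (Q • (y - (ηK + ηJ))) c = e c - (ηK c - (Q • ηK) c) := by
  have hcJ : c ∉ J := hc.elim (h.disjoint.notMem_of_mem_left ·)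
    fun hc => h.disjoint_right.notMem_of_mem_right (.inl hc)
  have hJ0 := h.smul_response_apply_eq_zero hJ hc
  rw [← hy]
  simp only [smul_sub, smul_add, Pi.sub_apply, Pi.add_apply, hJ.eq_zero c hcJ, hJ0]
  abel

theorem sub_mem_span (h : IsSeparation (fun b c => Q c b ≠ 0) K J ZK ZJ)
    (hQK : IsUnit (1 - block Q K)) (hy : y - Q • y = e)
    (hK : IsResponse Q K e ηK) (hJ : IsResponse Q J e ηJ) {c : C} (hc : c ∈ K ∪ ZK) :
    (y - (ηK + ηJ)) c ∈ span T (y '' (ZK ∪ ZJ)) := by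
  rcases hc with hc | hc
  · rw [Pi.sub_apply, Pi.add_apply, hJ.eq_zero c (h.disjoint.notMem_of_mem_left hc), add_zero]
    exact hK.sub_mem_span hQK hy (fun c hc => h.pred_left c (.inl hc)) hc
  · rw [Pi.sub_apply, Pi.add_apply, hK.eq_zero c (h.disjoint_left.notMem_of_mem_right (.inl hc)),
      hJ.eq_zero c (h.disjoint_right.notMem_of_mem_right (.inl hc)), add_zero, sub_zero]
    exact Submodule.subset_span ⟨c, .inl hc, rfl⟩

theorem innovation_mem (h : IsSeparation (fun b c => Q c b ≠ 0) K J ZK ZJ)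
    (hQK : IsUnit (1 - block Q K)) (hQJ : IsUnit (1 - block Q J)) (hy : y - Q • y = e)
    (hK : IsResponse Q K e ηK) (hJ : IsResponse Q J e ηJ) {c : C} (hc : c ∈ K ∪ ZK) :
    (y - (ηK + ηJ)) c - (Q • (y - (ηK + ηJ))) c ∈
      span T (y '' (ZK ∪ ZJ)) ⊓ span T (e '' (K ∪ ZK)) := by
  rw [Submodule.mem_inf]
  constructor
  · refine Submodule.sub_mem _ (h.sub_mem_span hQK hy hK hJ hc) (Submodule.sum_mem _ fun b _ => ?_)
    by_cases hcb : Q c b = 0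
    · rw [hcb, zero_smul]
      exact Submodule.zero_mem _
    refine Submodule.smul_mem _ _ ?_
    rcases h.pred_left c hc b hcb with hb | hb | hb
    · exact h.sub_mem_span hQK hy hK hJ (.inl hb)
    · exact h.sub_mem_span hQK hy hK hJ (.inr hb)
    · rw [add_comm ηK, Set.union_comm ZK]
      exact h.symm.sub_mem_span hQJ hy hJ hK (.inr hb)
  · have hηK (c : C) : ηK c ∈ span T (e '' (K ∪ ZK)) :=
      Submodule.span_mono (Set.image_mono Set.subset_union_left) (hK.mem_span hQK c)
    rw [h.sub_sub_smul_eq hy hJ hc]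
    exact Submodule.sub_mem _ (Submodule.subset_span ⟨c, hc, rfl⟩)
      (Submodule.sub_mem _ (hηK c) (matrix_smul_mem Q hηK c))

theorem sub_mem_sup (h : IsSeparation (fun b c => Q c b ≠ 0) K J ZK ZJ)
    (hQK : IsUnit (1 - block Q K)) (hQJ : IsUnit (1 - block Q J))
    (hQA : IsUnit (1 - block Q (K ∪ ZK ∪ (J ∪ ZJ)))) (hy : y - Q • y = e)
    (hK : IsResponse Q K e ηK) (hJ : IsResponse Q J e ηJ) {c : C} (hc : c ∈ K ∪ ZK ∪ (J ∪ ZJ)) :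
    (y - (ηK + ηJ)) c ∈ (span T (y '' (ZK ∪ ZJ)) ⊓ span T (e '' (K ∪ ZK))) ⊔
      (span T (y '' (ZK ∪ ZJ)) ⊓ span T (e '' (J ∪ ZJ))) := by
  refine mem_of_sub_smul_mem hQA (fun c hc => ?_) (fun c hc b hb => ?_) hc
  · rcases hc with hc | hc
    · exact Submodule.mem_sup_left (h.innovation_mem hQK hQJ hy hK hJ hc)
    · rw [add_comm ηK, Set.union_comm ZK]
      exact Submodule.mem_sup_right (h.symm.innovation_mem hQJ hQK hy hJ hK hc)
  · have hcb : Q c b = 0 := by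
      by_contra hcb
      refine hb (hc.elim (fun hc => ?_) fun hc => ?_)
      · rcases h.pred_left c hc b hcb with hb | hb | hb <;> simp [hb]
      · rcases h.pred_right c hc b hcb with hb | hb | hb <;> simp [hb]
    rw [hcb, zero_smul]
    exact Submodule.zero_mem _

theorem span_le_sup (h : IsSeparation (fun b c => Q c b ≠ 0) K J ZK ZJ)
    (hQK : IsUnit (1 - block Q K)) (hQJ : IsUnit (1 - block Q J))
    (hQA : IsUnit (1 - block Q (K ∪ ZK ∪ (J ∪ ZJ)))) (hy : y - Q • y = e) :
    span T (y '' (K ∪ (ZK ∪ ZJ))) ≤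
      span T (e '' (K ∪ ZK)) ⊔ (span T (y '' (ZK ∪ ZJ)) ⊓ span T (e '' (J ∪ ZJ))) := by
  obtain ⟨ηK, hK⟩ := exists_isResponse hQK e
  obtain ⟨ηJ, hJ⟩ := exists_isResponse hQJ e
  rw [Submodule.span_le]
  rintro _ ⟨c, hc, rfl⟩
  have hcJ : c ∉ J := hc.elim (h.disjoint.notMem_of_mem_left ·)
    (h.disjoint_right.notMem_of_mem_right ·)
  have hc' : c ∈ K ∪ ZK ∪ (J ∪ ZJ) := by
    rcases hc with hc | hc | hc <;> simp [hc]
  rw [SetLike.mem_coe, ← sub_add_cancel (y c) (ηK c)]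
  refine Submodule.add_mem _ ?_ (Submodule.mem_sup_left
    (Submodule.span_mono (Set.image_mono Set.subset_union_left) (hK.mem_span hQK c)))
  have hmem := h.sub_mem_sup hQK hQJ hQA hy hK hJ hc'
  rw [Pi.sub_apply, Pi.add_apply, hJ.eq_zero c hcJ, add_zero] at hmem
  exact SetLike.le_def.1 (sup_le_sup_right inf_le_right _) hmem

theorem exists_estimate (h : IsSeparation (fun b c => Q c b ≠ 0) K J ZK ZJ)
    (hQK : IsUnit (1 - block Q K)) (hQJ : IsUnit (1 - block Q J))
    (hQA : IsUnit (1 - block Q (K ∪ ZK ∪ (J ∪ ZJ)))) (hy : y - Q • y = e)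
    {c : C} (hc : c ∈ J) {q : M} (hq : q ∈ span T (y '' (K ∪ (ZK ∪ ZJ)))) :
    ∃ q' ∈ span T (y '' (ZK ∪ ZJ)), y c - q' ∈ span T (e '' (J ∪ ZJ)) ∧
      q - q' ∈ span T (e '' (K ∪ ZK)) := by
  obtain ⟨ηK, hK⟩ := exists_isResponse hQK e
  obtain ⟨ηJ, hJ⟩ := exists_isResponse hQJ e
  obtain ⟨a, ha, b, hb, rfl⟩ := Submodule.mem_sup.1 (h.span_le_sup hQK hQJ hQA hy hq)
  obtain ⟨p, hp, p', hp', hpp'⟩ :=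
    Submodule.mem_sup.1 (h.sub_mem_sup hQK hQJ hQA hy hK hJ (.inr (.inl hc)))
  have hyc : y c = p + p' + ηJ c := by
    simp [hpp', hK.eq_zero c (h.disjoint.notMem_of_mem_right hc)]
  have hηJ : ηJ c ∈ span T (e '' (J ∪ ZJ)) :=
    Submodule.span_mono (Set.image_mono Set.subset_union_left) (hJ.mem_span hQJ c)
  refine ⟨p + b, Submodule.add_mem _ hp.1 hb.1, ?_, ?_⟩
  · rw [show y c - (p + b) = p' + ηJ c - b by rw [hyc]; abel]
    exact Submodule.sub_mem _ (Submodule.add_mem _ hp'.2 hηJ) hb.2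
  · rw [add_sub_add_right_eq_sub]
    exact Submodule.sub_mem _ ha hp.2

end IsSeparation

end Network

/-! ### Processes as bounded sequences of square-integrable functions -/

section Representation

variable {Ω : Type*} [MeasurableSpace Ω] {μ : Measure Ω}

/-- The bounded sequence `X` in `L²` consists of the classes of the random variables `x t`. -/
def Represents (μ : Measure Ω) (x : ℤ → Ω → ℝ) (X : ℤ →ᵇ Lp ℝ 2 μ) : Prop :=
  ∀ t, x t =ᵐ[μ] X t

theorem exists_represents {x : ℤ → Ω → ℝ} (hx : ∀ t, MemLp (x t) 2 μ) {C : ℝ}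
    (hC : ∀ t, ∫ ω, x t ω * x t ω ∂μ = C) : ∃ X, Represents μ x X := by
  refine ⟨BoundedContinuousFunction.ofNormedAddCommGroupDiscrete (fun t => (hx t).toLp (x t))
    (√C) fun t => ?_, fun t => ((hx t).coeFn_toLp).symm⟩
  refine Real.le_sqrt_of_sq_le ?_
  rw [← real_inner_self_eq_norm_sq, L2.inner_def, ← hC t]
  refine (integral_congr_ae ?_).le
  filter_upwards [(hx t).coeFn_toLp] with ω hω
  simp [hω, sq]

namespace IsWSS

theorem exists_represents {ι : Type*} {x : ι → ℤ → Ω → ℝ} (hx : IsWSS μ x) :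
    ∃ X : ι → ℤ →ᵇ Lp ℝ 2 μ, ∀ a, Represents μ (x a) (X a) :=
  Classical.skolem.1 fun a => _root_.exists_represents (hx.memLp a)
    (C := ∫ ω, x a 0 ω * x a 0 ω ∂μ) fun t => by simpa using hx.corr a a t 0

end IsWSS

namespace IsUnitWhite

theorem exists_represents {ι : Type*} [DecidableEq ι] {u : ι → ℤ → Ω → ℝ}
    (hu : IsUnitWhite μ u) : ∃ U : ι → ℤ →ᵇ Lp ℝ 2 μ, ∀ a, Represents μ (u a) (U a) :=
  Classical.skolem.1 fun a => _root_.exists_represents (hu.memLp a) (C := 1)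
    fun t => by simpa using hu.corr a a t t

end IsUnitWhite

namespace Represents

variable {x z : ℤ → Ω → ℝ} {X Z : ℤ →ᵇ Lp ℝ 2 μ}

theorem unique (hX : Represents μ x X) (hZ : Represents μ x Z) : X = Z := by
  ext1 t
  exact Lp.ext ((hX t).symm.trans (hZ t))

theorem inner_eq (hX : Represents μ x X) (hZ : Represents μ z Z) (t s : ℤ) :
    inner ℝ (X t) (Z s) = ∫ ω, x t ω * z s ω ∂μ := by
  rw [L2.inner_def]
  refine integral_congr_ae ?_
  filter_upwards [hX t, hZ s] with ω hx hz
  simp [hx, hz, mul_comm]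

theorem filter (h : Represents μ x X) (P : tfRing) :
    Represents μ (fun t ω => ∑' k : ℤ, impulse (P : RatFunc ℝ) (t - k) * x k ω) (P • X) := by
  intro t
  have hsummable : Summable fun k => ‖resp P (t - k) • X k‖ := by
    have hresp : Summable fun k => ‖resp P (t - k)‖ := by
      simpa only [Function.comp_def, Equiv.subLeft_apply] using
        (Equiv.subLeft t).summable_iff.2 (summable_norm_resp P)
    refine (hresp.mul_right ‖X‖).of_nonneg_of_le (fun _ => norm_nonneg _) fun k => ?_
    rw [norm_smul]
    exact mul_le_mul_of_nonneg_left (X.norm_coe_le_norm k) (norm_nonneg _)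
  have htsum := Lp.coeFn_tsum (f := fun k => resp P (t - k) • X k)
    (tsum_enorm_ne_top_iff_summable_norm.2 hsummable)
  rw [(hasSum_tf_smul_apply_sub P X t).tsum_eq] at htsum
  filter_upwards [htsum, ae_all_iff.2 h,
    ae_all_iff.2 fun k => Lp.coeFn_smul (resp P (t - k)) (X k)] with ω hω hx hsmul
  simp only [hω, hx, hsmul]
  rfl

theorem applyTF {ι κ : Type*} [Fintype ι] {W : Matrix κ ι (RatFunc ℝ)} {x : ι → ℤ → Ω → ℝ}
    {X : ι → ℤ →ᵇ Lp ℝ 2 μ} (h : ∀ b, Represents μ (x b) (X b)) {a : κ} {w : ι → tfRing}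
    (hw : ∀ b, (w b : RatFunc ℝ) = W a b) :
    Represents μ (applyTF W x a) (∑ b, w b • X b) := by
  intro t
  rw [BoundedContinuousFunction.sum_apply]
  filter_upwards [Lp.coeFn_fun_finsetSum Finset.univ fun b => (w b • X b) t,
    ae_all_iff.2 fun b => (h b).filter (w b) t] with ω hsum hfilter
  rw [hsum]
  exact Finset.sum_congr rfl fun b _ => by rw [← hfilter b, hw]

theorem mse_eq {κ : Type*} [Fintype κ] {x q : κ → ℤ → Ω → ℝ} {X Y : κ → ℤ →ᵇ Lp ℝ 2 μ}
    (hx : ∀ a, Represents μ (x a) (X a)) (hq : ∀ a, Represents μ (q a) (Y a)) (t : ℤ) :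
    mse μ x q t = ∑ a, ‖X a t - Y a t‖ ^ 2 := by
  have hae (a : κ) : (fun ω => (x a t ω - q a t ω) ^ 2) =ᵐ[μ]
      fun ω => inner ℝ ((X a t - Y a t) ω) ((X a t - Y a t) ω) := by
    filter_upwards [hx a t, hq a t, Lp.coeFn_sub (X a t) (Y a t)] with ω hx hq hsub
    rw [hx, hq, hsub]
    simp [sq]
  rw [mse, integral_finsetSum]
  · refine Finset.sum_congr rfl fun a _ => ?_
    rw [← real_inner_self_eq_norm_sq, L2.inner_def]
    exact integral_congr_ae (hae a)
  · intro a _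
    exact (L2.integrable_inner (𝕜 := ℝ) (X a t - Y a t) (X a t - Y a t)).congr (hae a).symm

end Represents

end Representation

/-! ### Correlations of filtered sequences -/

section Correlation

variable {H : Type*} [NormedAddCommGroup H] [InnerProductSpace ℝ H]

/-- The correlations of `x` and `z` are stationary, with the rational cross spectrum `F`. -/
def HasCrossSpectrum (x z : ℤ →ᵇ H) (F : tfRing) : Prop :=
  ∀ t s, inner ℝ (x t) (z s) = resp F (t - s)

/-- All values of `x` are orthogonal to all values of `z`. -/
def SeqOrthogonal (x z : ℤ →ᵇ H) : Prop := ∀ t s, inner ℝ (x t) (z s) = 0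

theorem hasCrossSpectrum_zero {x z : ℤ →ᵇ H} : HasCrossSpectrum x z 0 ↔ SeqOrthogonal x z := by
  simp only [HasCrossSpectrum, SeqOrthogonal, map_zero, Pi.zero_apply]

theorem SeqOrthogonal.symm {x z : ℤ →ᵇ H} (h : SeqOrthogonal x z) : SeqOrthogonal z x :=
  fun t s => by rw [real_inner_comm, h s t]

namespace HasCrossSpectrum

variable {x y z : ℤ →ᵇ H} {F G : tfRing}

theorem add_left (hx : HasCrossSpectrum x z F) (hy : HasCrossSpectrum y z G) :
    HasCrossSpectrum (x + y) z (F + G) := fun t s => by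
  rw [BoundedContinuousFunction.add_apply, inner_add_left, hx t s, hy t s, map_add, Pi.add_apply]

theorem sum_left {ι : Type*} {s : Finset ι} {x : ι → ℤ →ᵇ H} {F : ι → tfRing}
    (h : ∀ i, HasCrossSpectrum (x i) z (F i)) :
    HasCrossSpectrum (∑ i ∈ s, x i) z (∑ i ∈ s, F i) := fun t r => by
  rw [BoundedContinuousFunction.sum_apply, sum_inner, map_sum, Finset.sum_apply]
  exact Finset.sum_congr rfl fun i _ => h i t r

theorem exists_symm (h : HasCrossSpectrum x z F) : ∃ R, HasCrossSpectrum z x R := by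
  obtain ⟨R, hR⟩ := exists_resp_eq_neg F
  exact ⟨R, fun t s => by rw [real_inner_comm, h s t, hR, neg_sub]⟩

variable [CompleteSpace H]

theorem smul_left (h : HasCrossSpectrum x z F) (P : tfRing) :
    HasCrossSpectrum (P • x) z (P * F) := fun t s => by
  have hsum : HasSum (fun k => inner ℝ (z s) (resp P k • x (t - k))) (inner ℝ (z s) ((P • x) t)) :=
    (hasSum_tf_smul_apply P x t).mapL (innerSL ℝ (z s))
  rw [real_inner_comm, ← hsum.tsum_eq, resp_mul]
  refine tsum_congr fun k => ?_
  rw [real_inner_smul_right, real_inner_comm, h, sub_right_comm]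

variable {T : Subring tfRing} {A B : Set (ℤ →ᵇ H)}

theorem exists_of_mem_span_left (h : ∀ a ∈ A, ∃ F, HasCrossSpectrum a z F)
    (hx : x ∈ Submodule.span T A) : ∃ F, HasCrossSpectrum x z F := by
  induction hx using Submodule.span_induction with
  | mem a ha => exact h a ha
  | zero => exact ⟨0, fun t s => by simp⟩
  | add x y _ _ hx hy =>
    obtain ⟨F, hF⟩ := hx
    obtain ⟨G, hG⟩ := hy
    exact ⟨F + G, hF.add_left hG⟩
  | smul P x _ hx =>
    obtain ⟨F, hF⟩ := hx
    exact ⟨P * F, hF.smul_left (P : tfRing)⟩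

theorem exists_of_mem_span (h : ∀ a ∈ A, ∀ b ∈ B, ∃ F, HasCrossSpectrum a b F)
    (hx : x ∈ Submodule.span T A) (hz : z ∈ Submodule.span T B) :
    ∃ F, HasCrossSpectrum x z F := by
  refine exists_of_mem_span_left (fun a ha => ?_) hx
  obtain ⟨F, hF⟩ := exists_of_mem_span_left (fun b hb => (h a ha b hb).choose_spec.exists_symm) hz
  exact hF.exists_symm

end HasCrossSpectrum

namespace SeqOrthogonal

variable [CompleteSpace H] {x z : ℤ →ᵇ H} {T : Subring tfRing} {A B : Set (ℤ →ᵇ H)}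

theorem of_mem_span_left (h : ∀ a ∈ A, SeqOrthogonal a z) (hx : x ∈ Submodule.span T A) :
    SeqOrthogonal x z := by
  simp only [← hasCrossSpectrum_zero] at h ⊢
  induction hx using Submodule.span_induction with
  | mem a ha => exact h a ha
  | zero => exact fun t s => by simp
  | add x y _ _ hx hy => simpa only [add_zero] using hx.add_left hy
  | smul P x _ hx => exact mul_zero (P : tfRing) ▸ hx.smul_left (P : tfRing)

theorem of_mem_span (h : ∀ a ∈ A, ∀ b ∈ B, SeqOrthogonal a b) (hx : x ∈ Submodule.span T A)
    (hz : z ∈ Submodule.span T B) : SeqOrthogonal x z :=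
  of_mem_span_left (fun a ha => (of_mem_span_left (fun b hb => (h a ha b hb).symm) hz).symm) hx

end SeqOrthogonal

end Correlation

/-! ### Wiener filters -/

theorem exists_eq_smul_unitImpulse_of_eq_resp {ι κ : Type*} [Fintype ι] [Finite κ]
    {A : Matrix κ ι tfRing} {φ : κ → tfRing} {w : ι → ℤ →ᵇ ℝ} {α : κ → ℤ →ᵇ ℝ}
    (hw : ∀ b, ∀ k < 0, w b k = 0) (hα : ∀ c, α c = ∑ b, A c b • w b)
    (hφ : ∀ c k, 0 ≤ k → α c k = resp (φ c) k) :
    ∃ β : κ → tfRing, ∀ c, α c = β c • unitImpulse := by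
  -- The common denominator `D` is a polynomial in the backward time shift. It preserves the
  -- vanishing of `α - φ` on nonnegative times, and turns `A` into an operator of finite range.
  obtain ⟨D, ⟨v, hv⟩, hD⟩ := exists_common_denom (Sum.elim φ fun cb : κ × ι => A cb.1 cb.2)
  choose p hp using fun c => hD (Sum.inl c)
  choose n hn using fun c b => hD (Sum.inr (c, b))
  simp only [Sum.elim_inl, Sum.elim_inr] at hp hn
  have hpos (c : κ) (k : ℤ) (hk : 1 ≤ k) : (polyTF D • α c) k = 0 := by
    have hsplit : polyTF D • α c =
        polyTF (p c) • unitImpulse + polyTF D • (α c - φ c • unitImpulse) := by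
      rw [smul_sub, smul_smul, hp]
      abel
    rw [hsplit, BoundedContinuousFunction.add_apply, tf_smul_unitImpulse, resp_polyTF,
      if_neg (by lia), zero_add]
    refine polyTF_smul_apply_eq_zero_of_le (n := 0) D (fun j hj => ?_) (by lia)
    rw [BoundedContinuousFunction.sub_apply, tf_smul_unitImpulse, hφ c j hj, sub_self]
  have hneg (c : κ) (k : ℤ) (hk : k < -(∑ b, (n c b).natDegree : ℕ)) :
      (polyTF D • α c) k = 0 := by
    rw [hα, Finset.smul_sum, BoundedContinuousFunction.sum_apply]
    refine Finset.sum_eq_zero fun b _ => ?_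
    have hle := Finset.single_le_sum (f := fun b => (n c b).natDegree) (fun _ _ => Nat.zero_le _)
      (Finset.mem_univ b)
    rw [smul_smul, hn]
    exact polyTF_smul_apply_eq_zero_of_lt _ (hw b) (by lia)
  choose r hr using fun c => exists_eq_polyTF_smul_unitImpulse (hpos c) (hneg c)
  refine ⟨fun c => ↑v⁻¹ * polyTF (r c), fun c => ?_⟩
  rw [mul_smul, ← hr, ← hv, smul_smul, Units.inv_mul, one_smul]

section Wiener

open scoped Matrix.Module

variable {H : Type*} [NormedAddCommGroup H] [InnerProductSpace ℝ H]

/-- The correlations of `h` with the sequence `y`, in reversed time. -/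
def corrSeq (y : ℤ →ᵇ H) : H →L[ℝ] (ℤ →ᵇ ℝ) :=
  LinearMap.mkContinuous
    { toFun := fun h => BoundedContinuousFunction.ofNormedAddCommGroupDiscrete
        (fun τ => inner ℝ h (y (-τ))) (‖h‖ * ‖y‖) fun τ =>
          (norm_inner_le_norm _ _).trans
            (mul_le_mul_of_nonneg_left (y.norm_coe_le_norm _) (norm_nonneg _))
      map_add' := fun _ _ => by
        ext
        simp [inner_add_left]
      map_smul' := fun _ _ => by
        ext
        simp [inner_smul_left] } ‖y‖
    fun h => (BoundedContinuousFunction.norm_le (by positivity)).2 fun τ => by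
      rw [mul_comm]
      exact (norm_inner_le_norm _ _).trans
        (mul_le_mul_of_nonneg_left (y.norm_coe_le_norm _) (norm_nonneg _))

theorem corrSeq_apply (y : ℤ →ᵇ H) (h : H) (τ : ℤ) : corrSeq y h τ = inner ℝ h (y (-τ)) := rfl

theorem HasCrossSpectrum.corrSeq_eq {x y : ℤ →ᵇ H} {F : tfRing} (h : HasCrossSpectrum x y F)
    (k : ℤ) : corrSeq y (x (-k)) = F • delay k unitImpulse := by
  ext τ
  rw [corrSeq_apply, h, tf_smul_delay, delay_apply, tf_smul_unitImpulse, neg_sub_neg]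

variable {ι : Type*} [Fintype ι] [DecidableEq ι] {y : ι → ℤ →ᵇ H} {Φ : Matrix ι ι tfRing}

/-- The coefficients `w` of `h = ∑ b, ∑ k, w b k • y b (-k)`, for signals `y` with the spectrum `Φ`.
They solve the normal equations `Φᵀ w = α`, where `α` are the correlations of `h` with `y`. -/
def coeffSeq (Φ : Matrix ι ι tfRing) (y : ι → ℤ →ᵇ H) : H →L[ℝ] (ι → ℤ →ᵇ ℝ) :=
  ContinuousLinearMap.pi fun b => ∑ c, (convHom ℝ (Φ⁻¹ c b)).comp (corrSeq (y c))

theorem coeffSeq_eq (h : H) : coeffSeq Φ y h = Φ⁻¹.transpose • fun c => corrSeq (y c) h := by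
  ext1 b
  simp only [coeffSeq, ContinuousLinearMap.coe_pi', sum_apply,
    ContinuousLinearMap.comp_apply]
  rfl

theorem transpose_smul_coeffSeq (hdet : IsUnit Φ.det) (h : H) :
    Φ.transpose • coeffSeq Φ y h = fun c => corrSeq (y c) h := by
  rw [coeffSeq_eq, smul_smul, ← Matrix.transpose_mul, Matrix.nonsing_inv_mul Φ hdet,
    Matrix.transpose_one, one_smul]

theorem coeffSeq_signal (hΦ : ∀ b c, HasCrossSpectrum (y b) (y c) (Φ b c)) (hdet : IsUnit Φ.det)
    (b : ι) (k : ℤ) : coeffSeq Φ y (y b (-k)) = Pi.single b (delay k unitImpulse) := by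
  have hcorr : (fun c => corrSeq (y c) (y b (-k))) =
      Φ.transpose • Pi.single b (delay k unitImpulse) := by
    ext1 c
    rw [(hΦ b c).corrSeq_eq k, Matrix.Module.smul_apply, Finset.sum_eq_single b]
    · simp
    · intro b' _ hb'
      rw [Pi.single_eq_of_ne hb', smul_zero]
    · simp
  rw [coeffSeq_eq, hcorr, smul_smul, ← Matrix.transpose_mul, Matrix.mul_nonsing_inv Φ hdet,
    Matrix.transpose_one, one_smul]

variable {K : AddSubmonoid ℤ}

/-- The closed span of the values of `y` that enter the estimates at time `0` of filters whose
impulse response is supported in `K`. -/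
def observed (K : AddSubmonoid ℤ) (y : ι → ℤ →ᵇ H) : Submodule ℝ H :=
  (Submodule.span ℝ {h | ∃ b, ∃ k ∈ K, h = y b (-k)}).topologicalClosure

theorem coeffSeq_apply_eq_zero (hΦ : ∀ b c, HasCrossSpectrum (y b) (y c) (Φ b c))
    (hdet : IsUnit Φ.det) {h : H} (hh : h ∈ observed K y) (b : ι) {j : ℤ} (hj : j ∉ K) :
    coeffSeq Φ y h b j = 0 := by
  set f : H →L[ℝ] ℝ := (BoundedContinuousFunction.evalCLM ℝ j).comp
    ((ContinuousLinearMap.proj b).comp (coeffSeq Φ y))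
  have hle : observed K y ≤ f.ker := by
    refine Submodule.topologicalClosure_minimal _ (Submodule.span_le.2 ?_) f.isClosed_ker
    rintro _ ⟨b', k, hk, rfl⟩
    change coeffSeq Φ y (y b' (-k)) b j = 0
    rw [coeffSeq_signal hΦ hdet]
    by_cases hb : b = b'
    · subst hb
      rw [Pi.single_eq_same, delay_apply, unitImpulse_apply, if_neg]
      rintro h0
      exact hj (sub_eq_zero.1 h0 ▸ hk)
    · rw [Pi.single_eq_of_ne hb, BoundedContinuousFunction.coe_zero, Pi.zero_apply]
  exact hle hh

theorem exists_corrSeq_eq_smul_unitImpulse (hK : K = ⊤ ∨ K = AddSubmonoid.nonneg ℤ)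
    (hΦ : ∀ b c, HasCrossSpectrum (y b) (y c) (Φ b c)) (hdet : IsUnit Φ.det) {φ : ι → tfRing}
    {h : H} (hh : h ∈ observed K y) (hφ : ∀ c, ∀ τ ∈ K, corrSeq (y c) h τ = resp (φ c) τ) :
    ∃ β : ι → tfRing, ∀ c, corrSeq (y c) h = β c • unitImpulse := by
  rcases hK with rfl | rfl
  · refine ⟨φ, fun c => ?_⟩
    ext τ
    rw [hφ c τ (AddSubmonoid.mem_top τ), tf_smul_unitImpulse]
  · exact exists_eq_smul_unitImpulse_of_eq_resp (w := coeffSeq Φ y h)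
      (fun b k hk => coeffSeq_apply_eq_zero hΦ hdet hh b fun h => hk.not_ge h)
      (fun c => (congrFun (transpose_smul_coeffSeq hdet h) c).symm) hφ

variable [CompleteSpace H]

theorem exists_wienerHopf_solution (hK : K = ⊤ ∨ K = AddSubmonoid.nonneg ℤ)
    (hΦ : ∀ b c, HasCrossSpectrum (y b) (y c) (Φ b c)) (hdet : IsUnit Φ.det) {x : ℤ →ᵇ H}
    {φ : ι → tfRing} (hφ : ∀ c, HasCrossSpectrum x (y c) (φ c)) :
    ∃ w : ι → tfRing, (∀ b, w b ∈ supportedRing K) ∧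
      ∀ c, ∀ k ∈ K, resp (φ c - ∑ b, w b * Φ b c) k = 0 := by
  have : CompleteSpace (observed K y) :=
    (Submodule.isClosed_topologicalClosure _).completeSpace_coe
  set p : H := (observed K y).starProjection (x 0)
  have hp : p ∈ observed K y := Submodule.starProjection_apply_mem _ _
  have hcorr (c : ι) (τ : ℤ) (hτ : τ ∈ K) : corrSeq (y c) p τ = resp (φ c) τ := by
    have horth : inner ℝ (x 0 - p) (y c (-τ)) = 0 :=
      Submodule.starProjection_inner_eq_zero _ _
        (Submodule.le_topologicalClosure _ (Submodule.subset_span ⟨c, τ, hτ, rfl⟩))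
    rw [inner_sub_left, hφ, sub_eq_zero] at horth
    rw [corrSeq_apply, ← horth, zero_sub, neg_neg]
  obtain ⟨β, hβ⟩ := exists_corrSeq_eq_smul_unitImpulse hK hΦ hdet hp hcorr
  refine ⟨Matrix.vecMul β Φ⁻¹, fun b k hk => ?_, fun c k hk => ?_⟩
  · rw [← tf_smul_unitImpulse, ← coeffSeq_apply_eq_zero hΦ hdet hp b hk, coeffSeq_eq,
      Matrix.Module.smul_apply]
    simp only [Matrix.vecMul, dotProduct, Finset.sum_smul, mul_comm (β _), mul_smul, hβ,
      Matrix.transpose_apply]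
  · have hW : ∑ b, Matrix.vecMul β Φ⁻¹ b * Φ b c = β c := by
      change Matrix.vecMul (Matrix.vecMul β Φ⁻¹) Φ c = β c
      rw [Matrix.vecMul_vecMul, Matrix.nonsing_inv_mul Φ hdet, Matrix.vecMul_one]
    rw [hW, map_sub, Pi.sub_apply, ← hcorr c k hk, hβ, tf_smul_unitImpulse, sub_self]

end Wiener

/-! ### Best approximations -/

section Approximation

variable {H : Type*} [NormedAddCommGroup H] [InnerProductSpace ℝ H] {κ : Type*} [Fintype κ]

theorem sum_norm_sub_sq_eq_add {x q p : κ → H} (h : ∀ a, inner ℝ (x a - p a) (q a - p a) = 0) :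
    ∑ a, ‖x a - q a‖ ^ 2 = ∑ a, ‖x a - p a‖ ^ 2 + ∑ a, ‖q a - p a‖ ^ 2 := by
  rw [← Finset.sum_add_distrib]
  refine Finset.sum_congr rfl fun a _ => ?_
  rw [← sub_sub_sub_cancel_right (x a) (q a) (p a), norm_sub_sq_real, h]
  ring

theorem sum_norm_sub_sq_le {x q p : κ → H} (h : ∀ a, inner ℝ (x a - p a) (q a - p a) = 0) :
    ∑ a, ‖x a - p a‖ ^ 2 ≤ ∑ a, ‖x a - q a‖ ^ 2 := by
  rw [sum_norm_sub_sq_eq_add h]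
  exact le_add_of_nonneg_right (Finset.sum_nonneg fun _ _ => sq_nonneg _)

theorem eq_of_sum_norm_sub_sq_le {x q p : κ → H}
    (h : ∀ a, inner ℝ (x a - p a) (q a - p a) = 0)
    (hle : ∑ a, ‖x a - q a‖ ^ 2 ≤ ∑ a, ‖x a - p a‖ ^ 2) : q = p := by
  have hzero : ∑ a, ‖q a - p a‖ ^ 2 = 0 := by
    refine le_antisymm ?_ (Finset.sum_nonneg fun _ _ => sq_nonneg _)
    rw [sum_norm_sub_sq_eq_add h] at hle
    linarith
  ext1 a
  have hnorm := (Finset.sum_eq_zero_iff_of_nonneg fun _ _ => sq_nonneg _).1 hzero a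
    (Finset.mem_univ a)
  exact sub_eq_zero.1 (norm_eq_zero.1 (pow_eq_zero_iff two_ne_zero |>.1 hnorm))

variable {N N' : Set (ℤ →ᵇ H)} {x q p : κ → ℤ →ᵇ H}

/-- The vector sequence `q` with components in `N` minimizes, at every time, the squared distance
to `x` among all such sequences: the form of the least squares problem of `IsWienerEstimate`
for sequences in a Hilbert space. -/
def IsBestApprox (N : Set (ℤ →ᵇ H)) (x q : κ → ℤ →ᵇ H) : Prop :=
  (∀ a, q a ∈ N) ∧ ∀ p : κ → ℤ →ᵇ H, (∀ a, p a ∈ N) →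
    ∀ t, ∑ a, ‖x a t - q a t‖ ^ 2 ≤ ∑ a, ‖x a t - p a t‖ ^ 2

theorem IsBestApprox.of_inner_eq_zero (hq : ∀ a, q a ∈ N)
    (h : ∀ a, ∀ p ∈ N, ∀ t, inner ℝ (x a t - q a t) (p t - q a t) = 0) : IsBestApprox N x q :=
  ⟨hq, fun p hp t => sum_norm_sub_sq_le fun a => h a (p a) (hp a) t⟩

theorem IsBestApprox.eq_of_inner_eq_zero (hq : IsBestApprox N x q) (hp : ∀ a, p a ∈ N)
    (h : ∀ a t, inner ℝ (x a t - p a t) (q a t - p a t) = 0) : q = p := by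
  ext1 a
  ext1 t
  exact congrFun (eq_of_sum_norm_sub_sq_le (fun a => h a t) (hq.2 p hp t)) a

/-- For the estimation of `x`, the sequences in `N'` are as good as those in `N`: every element of
`N` differs from some `p` in `N'` by a part that is uncorrelated with the error of `p`. -/
def IsSufficient (N N' : Set (ℤ →ᵇ H)) (x : ℤ →ᵇ H) : Prop :=
  ∀ q ∈ N, ∃ p ∈ N', SeqOrthogonal (x - p) (q - p)

theorem exists_sum_norm_sub_sq_le_of_isSufficient (h : ∀ a, IsSufficient N N' (x a))
    (hq : ∀ a, q a ∈ N) :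
    ∃ p : κ → ℤ →ᵇ H, (∀ a, p a ∈ N') ∧
      ∀ t, ∑ a, ‖x a t - p a t‖ ^ 2 ≤ ∑ a, ‖x a t - q a t‖ ^ 2 := by
  choose p hp horth using fun a => h a (q a) (hq a)
  exact ⟨p, hp, fun t => sum_norm_sub_sq_le fun a => horth a t t⟩

theorem isBestApprox_iff_of_isSufficient (hN : N' ⊆ N) (h : ∀ a, IsSufficient N N' (x a)) :
    IsBestApprox N x q ↔ IsBestApprox N' x q := by
  refine ⟨fun hq => ?_, fun hq => ⟨fun a => hN (hq.1 a), fun p hp t => ?_⟩⟩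
  · choose p hp horth using fun a => h a (q a) (hq.1 a)
    obtain rfl : q = p := hq.eq_of_inner_eq_zero (fun a => hN (hp a)) fun a t => horth a t t
    exact ⟨hp, fun p hp => hq.2 p fun a => hN (hp a)⟩
  · obtain ⟨p', hp', hle⟩ := exists_sum_norm_sub_sq_le_of_isSufficient h hp
    exact (hq.2 p' hp' t).trans (hle t)

end Approximation

section Spectrum

variable {H : Type*} [NormedAddCommGroup H] [InnerProductSpace ℝ H] [CompleteSpace H]
  {ι κ : Type*} {y : ι → ℤ →ᵇ H} {Φ : Matrix ι ι tfRing} {K : AddSubmonoid ℤ}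

theorem inner_eq_zero_of_mem_span {r q : ℤ →ᵇ H} {G : ι → tfRing}
    (hr : ∀ c, HasCrossSpectrum r (y c) (G c)) (hG : ∀ c, ∀ k ∈ K, resp (G c) k = 0)
    (hq : q ∈ Submodule.span (supportedRing K) (Set.range y)) (t : ℤ) :
    inner ℝ (r t) (q t) = 0 := by
  obtain ⟨v, rfl⟩ := Finsupp.mem_span_range_iff_exists_finsupp.1 hq
  rw [Finsupp.sum, BoundedContinuousFunction.sum_apply, inner_sum]
  refine Finset.sum_eq_zero fun b _ => ?_
  have hsum : HasSum (fun k => inner ℝ (r t) (resp (v b) k • y b (t - k)))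
      (inner ℝ (r t) ((v b • y b) t)) :=
    (hasSum_tf_smul_apply (v b) (y b) t).mapL (innerSL ℝ (r t))
  rw [← hsum.tsum_eq]
  refine (tsum_congr fun k => ?_).trans tsum_zero
  rw [real_inner_smul_right, hr b, sub_sub_cancel]
  by_cases hk : k ∈ K
  · rw [hG b k hk, mul_zero]
  · rw [(v b).2 k hk, zero_mul]

variable [Fintype ι]

theorem HasCrossSpectrum.sub_sum_smul_left {x z : ℤ →ᵇ H} {φ : tfRing} {F : ι → tfRing}
    (hx : HasCrossSpectrum x z φ) (hy : ∀ b, HasCrossSpectrum (y b) z (F b)) (w : ι → tfRing) :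
    HasCrossSpectrum (x - ∑ b, w b • y b) z (φ - ∑ b, w b * F b) := fun t s => by
  rw [BoundedContinuousFunction.sub_apply, inner_sub_left, hx, map_sub, Pi.sub_apply,
    HasCrossSpectrum.sum_left (fun b => (hy b).smul_left (w b))]

variable [DecidableEq ι]

theorem linearIndependent_of_isUnit_det (T : Subring tfRing)
    (hΦ : ∀ b c, HasCrossSpectrum (y b) (y c) (Φ b c)) (hdet : IsUnit Φ.det) :
    LinearIndependent T y := by
  rw [Fintype.linearIndependent_iff]
  intro g hg b
  have hvec : Matrix.vecMul (fun b => (g b : tfRing)) Φ = 0 := by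
    ext1 c
    refine resp_injective (funext fun t => ?_)
    have hsum : HasCrossSpectrum (∑ b, (g b : tfRing) • y b) (y c) (∑ b, (g b : tfRing) * Φ b c) :=
      .sum_left fun b => (hΦ b c).smul_left _
    have hzero : ∑ b, (g b : tfRing) • y b = 0 := hg
    rw [Pi.zero_apply, map_zero, Pi.zero_apply, ← sub_zero t]
    rw [hzero] at hsum
    exact (hsum t 0).symm.trans (inner_zero_left _)
  have hg0 := Matrix.vecMul_injective_of_isUnit ((Matrix.isUnit_iff_isUnit_det Φ).2 hdet)
    (hvec.trans (Matrix.zero_vecMul Φ).symm)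
  exact Subtype.ext (congrFun hg0 b)

theorem existsUnique_isBestApprox [Fintype κ] (hK : K = ⊤ ∨ K = AddSubmonoid.nonneg ℤ)
    (hΦ : ∀ b c, HasCrossSpectrum (y b) (y c) (Φ b c)) (hdet : IsUnit Φ.det)
    {x : κ → ℤ →ᵇ H} {φ : Matrix κ ι tfRing} (hφ : ∀ a c, HasCrossSpectrum (x a) (y c) (φ a c)) :
    ∃! q, IsBestApprox (Submodule.span (supportedRing K) (Set.range y) : Set (ℤ →ᵇ H)) x q := by
  choose w hwK hw using fun a => exists_wienerHopf_solution hK hΦ hdet (hφ a)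
  set q : κ → ℤ →ᵇ H := fun a => ∑ b, w a b • y b
  have hq (a : κ) : q a ∈ Submodule.span (supportedRing K) (Set.range y) :=
    Submodule.sum_mem _ fun b _ => Submodule.smul_mem _ (⟨w a b, hwK a b⟩ : supportedRing K)
      (Submodule.subset_span (Set.mem_range_self b))
  have horth (a : κ) (p) (hp : p ∈ Submodule.span (supportedRing K) (Set.range y)) (t : ℤ) :
      inner ℝ (x a t - q a t) (p t - q a t) = 0 :=
    inner_eq_zero_of_mem_span (fun c => (hφ a c).sub_sum_smul_left (hΦ · c) (w a)) (hw a)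
      (Submodule.sub_mem _ hp (hq a)) t
  exact ⟨q, .of_inner_eq_zero hq horth, fun p hp =>
    hp.eq_of_inner_eq_zero hq fun a t => horth a (p a) (hp.1 a) t⟩

end Spectrum

theorem eq_zero_of_sum_smul_mem_span_image {R M ι : Type*} [Ring R] [AddCommGroup M]
    [Module R M] [Fintype ι] {v : ι → M} (hv : LinearIndependent R v) {s : Set ι} {w : ι → R}
    (hw : ∑ b, w b • v b ∈ Submodule.span R (v '' s)) {b : ι} (hb : b ∉ s) : w b = 0 := by
  obtain ⟨l, hl, hlw⟩ := (Finsupp.mem_span_image_iff_linearCombination R).1 hw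
  rw [Finsupp.linearCombination_apply, Finsupp.sum_fintype _ _ (by simp)] at hlw
  rw [← Fintype.linearIndependent_iffₛ.1 hv l w hlw b]
  exact Finsupp.notMem_support_iff.1 fun hbl => hb (hl hbl)

/-! ### Wiener estimates and filters as best approximations -/

section Translation

variable {Ω : Type*} [MeasurableSpace Ω] {μ : Measure Ω} {T : Subring tfRing}
  {ι κ : Type*} [Fintype ι] {y : ι → ℤ → Ω → ℝ} {Y : ι → ℤ →ᵇ Lp ℝ 2 μ}

theorem exists_represents_of_mem_tfSpan (hY : ∀ b, Represents μ (y b) (Y b))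
    {q : κ → ℤ → Ω → ℝ} (hq : q ∈ tfSpan μ (tfClass T) y κ) :
    ∃ X : κ → ℤ →ᵇ Lp ℝ 2 μ, (∀ a, Represents μ (q a) (X a)) ∧
      ∀ a, X a ∈ Submodule.span T (Set.range Y) := by
  obtain ⟨W, hW, hqW⟩ := hq
  obtain ⟨w, hw⟩ := exists_matrix_lift hW
  refine ⟨fun a => ∑ b, w a b • Y b, fun a t => (hqW a t).trans ?_, fun a => ?_⟩
  · exact Represents.applyTF (w := fun b => (w a b : tfRing)) hY (hw a) t
  · exact Submodule.sum_mem _ fun b _ =>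
      Submodule.smul_mem _ _ (Submodule.subset_span (Set.mem_range_self b))

theorem mem_tfSpan_of_represents (hY : ∀ b, Represents μ (y b) (Y b)) {q : κ → ℤ → Ω → ℝ}
    {X : κ → ℤ →ᵇ Lp ℝ 2 μ} (hX : ∀ a, Represents μ (q a) (X a))
    (hspan : ∀ a, X a ∈ Submodule.span T (Set.range Y)) : q ∈ tfSpan μ (tfClass T) y κ := by
  choose w hw using fun a => (Submodule.mem_span_range_iff_exists_fun T).1 (hspan a)
  refine ⟨fun a b => (w a b : tfRing), fun a b => coe_mem_tfClass.2 (w a b).2,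
    fun a t => (hX a t).trans ?_⟩
  rw [← hw a]
  exact (Represents.applyTF (w := fun b => (w a b : tfRing)) hY (fun _ => rfl) t).symm

theorem isWienerEstimate_iff_isBestApprox [Fintype κ] (hY : ∀ b, Represents μ (y b) (Y b))
    {x q : κ → ℤ → Ω → ℝ} {X R : κ → ℤ →ᵇ Lp ℝ 2 μ} (hX : ∀ a, Represents μ (x a) (X a))
    (hR : ∀ a, Represents μ (q a) (R a)) :
    IsWienerEstimate μ (tfClass T) y x q ↔
      IsBestApprox (Submodule.span T (Set.range Y) : Set (ℤ →ᵇ Lp ℝ 2 μ)) X R := by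
  constructor
  · rintro ⟨hq, hopt⟩
    refine ⟨fun a => ?_, fun R' hR' t => ?_⟩
    · obtain ⟨R', hR', hspan⟩ := exists_represents_of_mem_tfSpan hY hq
      rw [(hR a).unique (hR' a)]
      exact hspan a
    · have hrep (a : κ) : Represents μ (fun t ω => R' a t ω) (R' a) := fun _ => .rfl
      rw [← Represents.mse_eq hX hR, ← Represents.mse_eq hX hrep]
      exact hopt _ (mem_tfSpan_of_represents hY hrep hR') t
  · rintro ⟨hspan, hopt⟩
    refine ⟨mem_tfSpan_of_represents hY hR hspan, fun q' hq' t => ?_⟩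
    obtain ⟨R', hR', hspan'⟩ := exists_represents_of_mem_tfSpan hY hq'
    rw [Represents.mse_eq hX hR, Represents.mse_eq hX hR']
    exact hopt R' hspan' t

theorem isWienerFilter_iff_isBestApprox [Fintype κ] (hY : ∀ b, Represents μ (y b) (Y b))
    {x : κ → ℤ → Ω → ℝ} {X : κ → ℤ →ᵇ Lp ℝ 2 μ} (hX : ∀ a, Represents μ (x a) (X a))
    {W : Matrix κ ι (RatFunc ℝ)} {w : Matrix κ ι T}
    (hw : ∀ a b, ((w a b : tfRing) : RatFunc ℝ) = W a b) :
    IsWienerFilter μ (tfClass T) y x W ↔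
      IsBestApprox (Submodule.span T (Set.range Y) : Set (ℤ →ᵇ Lp ℝ 2 μ)) X
        fun a => ∑ b, w a b • Y b := by
  have hrep (a : κ) : Represents μ (applyTF W y a) (∑ b, w a b • Y b) :=
    Represents.applyTF (w := fun b => (w a b : tfRing)) hY (hw a)
  rw [← isWienerEstimate_iff_isBestApprox hY hX hrep]
  exact and_iff_right fun a b => hw a b ▸ coe_mem_tfClass.2 (w a b).2

end Translation

/-! ### Wiener separation of nodes -/

section Nodes

variable {V Ω : Type*} [MeasurableSpace Ω] {μ : Measure Ω} {T : Subring tfRing} {d : V → ℕ}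
  {y : Comp d → ℤ → Ω → ℝ} {Y : Comp d → ℤ →ᵇ Lp ℝ 2 μ} {I Z J : Finset V}

/-- The combinations of the signals of the nodes in `S` with coefficients in `T`; it represents
`tfspan (y_S)` if `T` is the ring of all transfer functions, and `ctfspan (y_S)` if `T` is the ring
of the causal ones. -/
def nodeSpan (T : Subring tfRing) (Y : Comp d → ℤ →ᵇ Lp ℝ 2 μ) (S : Finset V) :
    Submodule T (ℤ →ᵇ Lp ℝ 2 μ) :=
  Submodule.span T (Set.range fun c : CompOn d S => Y c.1)

theorem nodeSpan_eq (T : Subring tfRing) (Y : Comp d → ℤ →ᵇ Lp ℝ 2 μ) (S : Finset V) :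
    nodeSpan T Y S = Submodule.span T (Y '' (Sigma.fst ⁻¹' (S : Set V))) := by
  rw [nodeSpan, Set.image_eq_range]
  rfl

theorem nodeSpan_mono {S S' : Finset V} (h : S ⊆ S') : nodeSpan T Y S ≤ nodeSpan T Y S' := by
  rw [nodeSpan_eq, nodeSpan_eq]
  exact Submodule.span_mono (Set.image_mono fun _ hc => h hc)

theorem nodeSpan_eq_span_image {S S' : Finset V} (h : S ⊆ S') :
    nodeSpan T Y S =
      Submodule.span T ((fun c : CompOn d S' => Y c.1) '' {c | c.1.1 ∈ S}) := by
  rw [nodeSpan_eq]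
  congr 1
  ext x
  constructor
  · rintro ⟨c, hc, rfl⟩
    exact ⟨⟨c, h hc⟩, hc, rfl⟩
  · rintro ⟨c, hc, rfl⟩
    exact ⟨c.1, hc, rfl⟩

theorem isUnit_det_of_posDef_psd {ι : Type*} [Fintype ι] [DecidableEq ι] {y : ι → ℤ → Ω → ℝ}
    {Y : ι → ℤ →ᵇ Lp ℝ 2 μ} {Φ : Matrix ι ι tfRing} (hY : ∀ b, Represents μ (y b) (Y b))
    (hΦ : ∀ b c, HasCrossSpectrum (Y b) (Y c) (Φ b c))
    (hpos : ∀ z : ℂ, ‖z‖ = 1 → (psd μ y z).PosDef) : IsUnit Φ.det := by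
  refine isUnit_of_tfEvalHom_ne_zero fun z hz => ?_
  have hpsd : (tfEvalHom z hz).mapMatrix Φ = psd μ y z := by
    ext b c
    refine (hasSum_resp (Φ b c) z hz).tsum_eq.symm.trans (tsum_congr fun τ => ?_)
    rw [← (hY b).inner_eq (hY c), hΦ b c, sub_zero]
  rw [RingHom.map_det, hpsd]
  exact (hpos z hz).det_pos.ne'

variable [Fintype V] [DecidableEq V]

theorem noImprovement_of_isSufficient (hY : ∀ c, Represents μ (y c) (Y c))
    (h : ∀ a : CompOn d J, IsSufficient (nodeSpan T Y (I ∪ Z)) (nodeSpan T Y Z) (Y a.1)) :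
    NoImprovement μ (tfClass T) y I Z J := by
  intro q hq
  obtain ⟨R, hR, hspan⟩ := exists_represents_of_mem_tfSpan (fun b : CompOn d (I ∪ Z) => hY b.1) hq
  obtain ⟨R', hspan', hle⟩ := exists_sum_norm_sub_sq_le_of_isSufficient h hspan
  have hR' (a : CompOn d J) : Represents μ (fun t ω => R' a t ω) (R' a) := fun _ => .rfl
  have hYJ (a : CompOn d J) : Represents μ (restrictTo y J a) (Y a.1) := hY a.1
  refine ⟨_, mem_tfSpan_of_represents (fun b : CompOn d Z => hY b.1) hR' hspan', fun t => ?_⟩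
  rw [Represents.mse_eq hYJ hR', Represents.mse_eq hYJ hR]
  exact hle t

theorem estimatesCoincide_of_isSufficient (hY : ∀ c, Represents μ (y c) (Y c))
    (h : ∀ a : CompOn d J, IsSufficient (nodeSpan T Y (I ∪ Z)) (nodeSpan T Y Z) (Y a.1)) :
    EstimatesCoincide μ (tfClass T) y I Z J := by
  intro q
  have hYS (S : Finset V) (b : CompOn d S) : Represents μ (restrictTo y S b) (Y b.1) := hY b.1
  have hiff {R : CompOn d J → ℤ →ᵇ Lp ℝ 2 μ} (hR : ∀ a, Represents μ (q a) (R a)) :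
      IsWienerEstimate μ (tfClass T) (restrictTo y (I ∪ Z)) (restrictTo y J) q ↔
        IsWienerEstimate μ (tfClass T) (restrictTo y Z) (restrictTo y J) q := by
    rw [isWienerEstimate_iff_isBestApprox (hYS _) (hYS J) hR,
      isWienerEstimate_iff_isBestApprox (hYS _) (hYS J) hR]
    exact isBestApprox_iff_of_isSufficient (nodeSpan_mono Finset.subset_union_right) h
  constructor <;> intro hq
  · obtain ⟨R, hR, -⟩ := exists_represents_of_mem_tfSpan (hYS (I ∪ Z)) hq.1
    exact (hiff hR).1 hq
  · obtain ⟨R, hR, -⟩ := exists_represents_of_mem_tfSpan (hYS Z) hq.1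
    exact (hiff hR).2 hq

variable {K : AddSubmonoid ℤ} {Φ : Matrix (Comp d) (Comp d) tfRing}

theorem filterVanishesOn_of_isSufficient (hK : K = ⊤ ∨ K = AddSubmonoid.nonneg ℤ)
    (hY : ∀ c, Represents μ (y c) (Y c)) (hΦ : ∀ b c, HasCrossSpectrum (Y b) (Y c) (Φ b c))
    (hdet : IsUnit (Φ.submatrix (Subtype.val : CompOn d (I ∪ Z) → Comp d) Subtype.val).det)
    (hIZ : Disjoint I Z) (h : ∀ a : CompOn d J, IsSufficient (nodeSpan (supportedRing K) Y (I ∪ Z))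
      (nodeSpan (supportedRing K) Y Z) (Y a.1)) :
    FilterVanishesOn μ (tfClass (supportedRing K)) y I Z J := by
  have hYS (S : Finset V) (b : CompOn d S) : Represents μ (restrictTo y S b) (Y b.1) := hY b.1
  have hind : LinearIndependent (supportedRing K) fun b : CompOn d (I ∪ Z) => Y b.1 :=
    linearIndependent_of_isUnit_det _ (fun b c => hΦ b.1 c.1) hdet
  obtain ⟨R, hR, huniq⟩ := existsUnique_isBestApprox hK (fun b c => hΦ b.1 c.1) hdet
    fun (a : CompOn d J) c => hΦ a.1 c.1
  choose w hw using fun a => (Submodule.mem_span_range_iff_exists_fun _).1 (hR.1 a)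
  refine ⟨Matrix.of fun a b => ((w a b : tfRing) : RatFunc ℝ), ?_, fun W' hW' => ?_,
    fun a b hb => ?_⟩
  · exact (isWienerFilter_iff_isBestApprox (hYS _) (hYS J) fun _ _ => rfl).2
      (by simpa only [hw] using hR)
  · obtain ⟨w', hw'⟩ := exists_matrix_lift hW'.1
    have heq := huniq _ ((isWienerFilter_iff_isBestApprox (hYS _) (hYS J) hw').1 hW')
    ext a b
    rw [← hw', Matrix.of_apply, Fintype.linearIndependent_iffₛ.1 hind (w' a) (w a)
      ((congrFun heq a).trans (hw a).symm) b]
  · have hRZ := ((isBestApprox_iff_of_isSufficient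
      (nodeSpan_mono Finset.subset_union_right) h).1 hR).1 a
    rw [nodeSpan_eq_span_image (Finset.subset_union_right (s₁ := I)), SetLike.mem_coe,
      ← hw a] at hRZ
    have hwb : w a b = 0 := eq_zero_of_sum_smul_mem_span_image hind hRZ
      (Finset.disjoint_left.1 hIZ hb)
    rw [Matrix.of_apply, hwb]
    rfl

end Nodes

/-! ### Linear dynamic influence models -/

namespace LDIM

open scoped Matrix.Module

variable {V Ω : Type*} [Fintype V] [DecidableEq V] [MeasurableSpace Ω] {μ : Measure Ω}
  {d m : V → ℕ} {L : LDIM μ d m} {T : Subring tfRing} {Q : Matrix (Comp d) (Comp d) T}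
  {Y E : Comp d → ℤ →ᵇ Lp ℝ 2 μ}

theorem InvertibleIn.isUnit_one_sub_block (hL : L.InvertibleIn (tfClass T))
    (hQ : ∀ a b, ((Q a b : tfRing) : RatFunc ℝ) = L.Q a b) (S : Set V) :
    IsUnit (1 - block Q (Sigma.fst ⁻¹' S)) := by
  lift S to Finset V using S.toFinite
  obtain ⟨N, hN, hmem⟩ := hL S
  obtain ⟨n, hn⟩ := exists_matrix_lift hmem
  let f : T →+* RatFunc ℝ := tfRing.subtype.comp T.subtype
  have hf : Function.Injective f := Subtype.val_injective.comp Subtype.val_injective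
  have hmul : (1 - Q.submatrix (Subtype.val : CompOn d S → Comp d) Subtype.val) * n = 1 := by
    refine Matrix.map_injective hf ?_
    change f.mapMatrix _ = f.mapMatrix _
    rw [map_mul, map_sub, map_one]
    convert! hN using 3
    · ext a b
      exact hQ a.1 b.1
    · ext a b
      exact hn a b
  classical
  refine _root_.isUnit_one_sub_block ?_
  convert! IsUnit.of_mul_eq_one _ hmul

theorem exists_represents_input (L : LDIM μ d m) : ∃ E : Comp d → ℤ →ᵇ Lp ℝ 2 μ,
    (∀ a, Represents μ (applyTF L.P L.u a) (E a)) ∧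
    (∀ a b, ∃ F, HasCrossSpectrum (E a) (E b) F) ∧
    ∀ a b, a.1 ≠ b.1 → SeqOrthogonal (E a) (E b) := by
  obtain ⟨U, hU⟩ := L.u_white.exists_represents
  obtain ⟨P, hP⟩ := exists_matrix_lift (W := L.P) (T := supportedRing ⊤) fun a b =>
    tfClass_supportedRing_top ▸ (L.P_mem a b).1
  have hwhite (a b : Comp m) : HasCrossSpectrum (U a) (U b) (if a = b then 1 else 0) := by
    intro t s
    rw [(hU a).inner_eq (hU b), L.u_white.corr]
    by_cases hab : a = b <;> simp [hab, resp_one, sub_eq_zero]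
  have hspan (a : Comp d) :
      ∑ c, P a c • U c ∈ Submodule.span (supportedRing ⊤) (U '' {c | a.1 = c.1}) := by
    refine Submodule.sum_mem _ fun c _ => ?_
    by_cases hac : a.1 = c.1
    · exact Submodule.smul_mem _ _ (Submodule.subset_span ⟨c, hac, rfl⟩)
    · have hzero : P a c = 0 := Subtype.ext (Subtype.ext ((hP a c).trans
        (L.P_blockDiagonal a c hac)))
      rw [hzero, zero_smul]
      exact Submodule.zero_mem _
  refine ⟨fun a => ∑ c, P a c • U c,
    fun a => Represents.applyTF (w := fun c => (P a c : tfRing)) hU (hP a), fun a b => ?_,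
    fun a b hab => ?_⟩
  · refine HasCrossSpectrum.exists_of_mem_span ?_ (hspan a) (hspan b)
    rintro _ ⟨c, -, rfl⟩ _ ⟨c', -, rfl⟩
    exact ⟨_, hwhite c c'⟩
  · refine SeqOrthogonal.of_mem_span ?_ (hspan a) (hspan b)
    rintro _ ⟨c, hc, rfl⟩ _ ⟨c', hc', rfl⟩
    have hcc' : c ≠ c' := by
      rintro rfl
      exact hab (hc.trans hc'.symm)
    rw [← hasCrossSpectrum_zero]
    simpa only [if_neg hcc'] using hwhite c c'

theorem sub_smul_eq_of_represents (hQ : ∀ a b, ((Q a b : tfRing) : RatFunc ℝ) = L.Q a b)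
    (hY : ∀ c, Represents μ (L.y c) (Y c))
    (hE : ∀ c, Represents μ (applyTF L.P L.u c) (E c)) : Y - Q • Y = E := by
  ext1 c
  rw [Pi.sub_apply, sub_eq_iff_eq_add']
  refine (hY c).unique fun t => (L.dynamics c t).trans ?_
  have hQY : Represents μ (applyTF L.Q L.y c) ((Q • Y) c) :=
    Represents.applyTF (w := fun b => (Q c b : tfRing)) hY (hQ c)
  filter_upwards [hQY t, hE c t, Lp.coeFn_add ((Q • Y) c t) (E c t)] with ω hω hω' hadd
  rw [hω, hω', BoundedContinuousFunction.add_apply, hadd, Pi.add_apply]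

theorem isSufficient_of_dSep (hL : L.InvertibleIn (tfClass T)) (hQ : ∀ a b, L.Q a b ∈ tfClass T)
    {G : Digraph V} (hG : L.IsRepresentedBy G) {I Z J : Finset V} (hIZ : Disjoint I Z)
    (hZJ : Disjoint Z J) (hsep : DSep G I Z J) (hY : ∀ c, Represents μ (L.y c) (Y c))
    (a : CompOn d J) : IsSufficient (nodeSpan T Y (I ∪ Z)) (nodeSpan T Y Z) (Y a.1) := by
  obtain ⟨Q, hQ⟩ := exists_matrix_lift hQ
  obtain ⟨E, hE, -, horth⟩ := L.exists_represents_input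
  obtain ⟨K, K', ZK, ZK', h, hZ, hIK, hJK'⟩ := hsep.exists_isSeparation hIZ hZJ
  have hadj (b c : Comp d) (hcb : Q c b ≠ 0) : G.Adj b.1 c.1 := by
    by_contra hbc
    exact hcb (Subtype.ext (Subtype.ext ((hQ c b).trans (hG b.1 c.1 hbc c.2 b.2))))
  intro q hq
  have hq' : q ∈ Submodule.span T
      (Y '' (Sigma.fst ⁻¹' K ∪ (Sigma.fst ⁻¹' ZK ∪ Sigma.fst ⁻¹' ZK'))) := by
    rw [SetLike.mem_coe, nodeSpan_eq, Finset.coe_union] at hq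
    rw [← Set.preimage_union, ← Set.preimage_union, hZ]
    exact Submodule.span_mono
      (Set.image_mono (Set.preimage_mono (Set.union_subset_union_left _ hIK))) hq
  obtain ⟨p, hp, hYp, hqp⟩ := (h.comap Sigma.fst hadj).exists_estimate
    (hL.isUnit_one_sub_block hQ K) (hL.isUnit_one_sub_block hQ K')
    (hL.isUnit_one_sub_block hQ (K ∪ ZK ∪ (K' ∪ ZK')))
    (sub_smul_eq_of_represents hQ hY hE) (hJK' a.2) hq'
  refine ⟨p, ?_, SeqOrthogonal.of_mem_span ?_ hYp hqp⟩
  · rwa [SetLike.mem_coe, nodeSpan_eq, ← hZ, Set.preimage_union]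
  · rintro _ ⟨b, hb, rfl⟩ _ ⟨c, hc, rfl⟩
    exact horth b c (h.disjoint_union.symm.ne_of_mem hb hc)

theorem exists_spectrum (hwp : L.IsWellPosed) (hY : ∀ c, Represents μ (L.y c) (Y c)) :
    ∃ Φ : Matrix (Comp d) (Comp d) tfRing, ∀ b c, HasCrossSpectrum (Y b) (Y c) (Φ b c) := by
  rw [IsWellPosed, ← tfClass_supportedRing_top] at hwp
  obtain ⟨Q, hQ⟩ := exists_matrix_lift (W := L.Q) (T := supportedRing ⊤) fun a b =>
    tfClass_supportedRing_top ▸ L.Q_mem a b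
  obtain ⟨E, hE, hspec, -⟩ := L.exists_represents_input
  have hspan (c : Comp d) : Y c ∈ Submodule.span (supportedRing ⊤) (Set.range E) := by
    refine mem_of_sub_smul_mem (hwp.isUnit_one_sub_block hQ Set.univ) (fun c _ => ?_)
      (fun _ _ b hb => (hb trivial).elim) (Set.mem_univ c)
    rw [← Pi.sub_apply, sub_smul_eq_of_represents hQ hY hE]
    exact Submodule.subset_span (Set.mem_range_self c)
  choose Φ hΦ using fun b c => HasCrossSpectrum.exists_of_mem_span
    (Set.forall_mem_range.2 fun a => Set.forall_mem_range.2 (hspec a)) (hspan b) (hspan c)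
  exact ⟨Φ, hΦ⟩

theorem wienerSepIn_of_dSep {K : AddSubmonoid ℤ} (hK : K = ⊤ ∨ K = AddSubmonoid.nonneg ℤ)
    (hwp : L.IsWellPosed) (hL : L.InvertibleIn (tfClass (supportedRing K)))
    (hQ : ∀ a b, L.Q a b ∈ tfClass (supportedRing K)) {G : Digraph V} (hG : L.IsRepresentedBy G)
    {I Z J : Finset V} (hIZ : Disjoint I Z) (hZJ : Disjoint Z J) (hsep : DSep G I Z J) :
    WienerSepIn μ (tfClass (supportedRing K)) L.y I Z J := by
  obtain ⟨Y, hY⟩ := L.y_wss.exists_represents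
  obtain ⟨Φ, hΦ⟩ := exists_spectrum hwp hY
  have h := isSufficient_of_dSep hL hQ hG hIZ hZJ hsep hY
  exact ⟨estimatesCoincide_of_isSufficient hY h, noImprovement_of_isSufficient hY h, fun hpos =>
    filterVanishesOn_of_isSufficient hK hY hΦ
      (isUnit_det_of_posDef_psd (fun b => hY b.1) (fun b c => hΦ b.1 c.1) hpos) hIZ h⟩

end LDIM

theorem mainTheorem1_general {V Ω : Type*} [Fintype V] [DecidableEq V] [MeasurableSpace Ω]
    (μ : Measure Ω) (d m : V → ℕ) (L : LDIM μ d m)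
    (hwp : L.IsWellPosed) (G : Digraph V) (hG : L.IsRepresentedBy G)
    (I Z J : Finset V) (hIZ : Disjoint I Z) (hZJ : Disjoint Z J)
    (hsep : DSep G I Z J) :
    WSep μ L.y I Z J ∧
      (L.IsCausal → L.IsCausallyWellPosed → CWSep μ L.y I Z J) := by
  constructor
  · have h := L.wienerSepIn_of_dSep (K := ⊤) (.inl rfl) hwp
    rw [tfClass_supportedRing_top] at h
    exact h hwp L.Q_mem hG hIZ hZJ hsep
  · intro hcausal hcwp
    have h := L.wienerSepIn_of_dSep (.inr rfl) hwp
    rw [tfClass_supportedRing_nonneg] at h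
    exact h hcwp hcausal hG hIZ hZJ hsep

end

theorem mainTheorem1 {V Ω : Type*} [Fintype V] [DecidableEq V] [MeasurableSpace Ω]
    (μ : Measure Ω) [IsProbabilityMeasure μ] (d m : V → ℕ) (L : LDIM μ d m)
    (hwp : L.IsWellPosed) (G : Digraph V) (hG : L.IsRepresentedBy G)
    (I Z J : Finset V) (hIZ : Disjoint I Z) (hIJ : Disjoint I J) (hZJ : Disjoint Z J)
    (hsep : DSep G I Z J) :
    WSep μ L.y I Z J ∧
      (L.IsCausal → L.IsCausallyWellPosed → CWSep μ L.y I Z J) :=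
  mainTheorem1_general μ d m L hwp G hG I Z J hIZ hZJ hsep
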